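/- **Setting.** Finite types are generated from $0$ (numbers) by $\sigma\to\tau$ and $\sigma^*$ (finite sequences); $1=0\to0$ and $2=1\to0$. $\mathsf{E\text{-}PA}^{\omega*}$ is classical Peano arithmetic in all these types: many-sorted classical logic with equality; constants $0$, $S$, the combinators $\Pi,\Sigma$, recursors for numbers, the empty sequence, the operation of prepending an element to a sequence, and recursors for finite sequences, with their defining equations; the successor axioms; "every sequence is empty or has a first element"; extensionality; and induction for all formulas. The language of $\mathsf P$ adds a predicate $\mathrm{st}$ ("standard") at each type; a formula is internal if it does not contain $\mathrm{st}$; $\forall^{\mathrm{st}},\exists^{\mathrm{st}}$ are quantifiers relativised to $\mathrm{st}$; and $N\in\Omega$ means that $N^0$ is a number with $\neg\mathrm{st}(N)$. The system $\mathsf P$ is $\mathsf{E\text{-}PA}^{\omega*}$ (induction being for internal formulas) together with the following axioms, in which parameters are allowed: * $\mathrm{st}(x)\wedge x=y\to\mathrm{st}(y)$; $\mathrm{st}(t)$ for closed terms $t$; $\mathrm{st}(f)\wedge\mathrm{st}(x)\to\mathrm{st}(f(x))$; * $\big(\Phi(0)\wedge(\forall^{\mathrm{st}}n^0)(\Phi(n)\to\Phi(n+1))\big)\to(\forall^{\mathrm{st}}n^0)\Phi(n)$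 for every formula $\Phi$; * $(\forall^{\mathrm{st}}x^\rho)(\exists^{\mathrm{st}}y^\tau)\varphi(x,y)\to(\exists^{\mathrm{st}}F^{\rho\to\tau^*})(\forall^{\mathrm{st}}x^\rho)(\exists y\in F(x))\varphi(x,y)$ for internal $\varphi$; * $(\forall^{\mathrm{st}}x^{\sigma^*})(\exists y^\tau)(\forall z\in x)\varphi(z,y)\to(\exists y^\tau)(\forall^{\mathrm{st}}x^\sigma)\varphi(x,y)$ for internal $\varphi$. For $f,g$ of type $1$ write $f\approx_1g$ for $(\forall^{\mathrm{st}}n^0)(f(n)=g(n))$, and $f\le_11$ for $(\forall n^0)(f(n)\le1)$. For $Y$ of type $2$, "$Y\in C$" is the internal formula $$(\forall f^1)(\exists N^0)(\forall g^1)\big((\forall i\le N)(g(i)=f(i))\to Y(f)=Y(g)\big).$$ The principles $\mathsf{NPC}$ and $\mathsf{STP}$ are $$\mathsf{NPC}:\ (\forall^{\mathrm{st}}Y^2\in C,f^1)(\forall g^1)\big(f\approx_1g\to Y(f)=Y(g)\big),\qquad \mathsf{STP}:\ (\forall f^1\le_11)(\exists^{\mathrm{st}}g^1\le_11)(f\approx_1g).$$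 The canonical approximations of the Gandy–Hyland functional are the functionals $H$ and $G$, given by closed (primitive recursive) terms of the language, for which $\mathsf P$ proves, for all $Y^2$, all finite sequences $s^{0^*}$ and all numbers $M,N$, $$H(Y,s,M)=\begin{cases}Y\big(s(0)*\dots*s(M)*00\dots\big)&|s|\ge M\\ Y\big(s*0*H(Y,s*1,M)*\dots*H(Y,s*M,M)*00\dots\big)&\text{otherwise,}\end{cases}$$ $$G(Y,s,N)=\begin{cases}Y(s*00\dots)&|s|\ge N\\ Y\big(s*0*(\lambda n)\,G(Y,s*(n+1),N)\big)&\text{otherwise.}\end{cases}$$ Here $|s|$ is the length of $s$, $s*n$ is $s$ followed by the entry $n$, and $s(i)=0$ for $i\ge|s|$. **Theorem 4.1.** The system $\mathsf P+\mathsf{NPC}+\mathsf{STP}$ proves $$(\forall^{\mathrm{st}}Y^2\in C,\,s^{0^*})(\forall M,N\in\Omega)\big(H(Y,s,N)=H(Y,s,M)\big)$$ and $$(\forall^{\mathrm{st}}Y^2\in C,\,s^{0^*})(\forall M,N\in\Omega)\big(G(Y,s,N)=G(Y,s,M)\big),$$ i.e. the canonical approximations are $\Omega$-invariant. -/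

import Mathlib

/-!  The nonstandard system `P` (classical Peano arithmetic in all finite types, with types of finite
sequences, a standardness predicate, external induction, herbrandised choice and idealisation),
given as a formal system: types, terms, formulas, axioms and derivations. -/

namespace PSys

/-! ### Types and terms -/

/-- Finite types: numbers, functions, finite sequences. -/
inductive Ty : Type
  | nat : Ty
  | arr : Ty → Ty → Ty
  | seq : Ty → Ty

infixr:60 " ⇒ " => Ty.arr

/-- The type written `1`, of functions from numbers to numbers. -/
abbrev ty1 : Ty := Ty.nat ⇒ Ty.nat

/-- The type written `2`, of functionals on Baire space. -/
abbrev ty2 : Ty := ty1 ⇒ Ty.nat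

/-- The type `0*` of finite sequences of numbers. -/
abbrev natSeq : Ty := Ty.seq Ty.nat

/-- A context is the list of the types of the free variables. -/
abbrev Ctx : Type := List Ty

/-- Variables of type `σ` in a context (typed de Bruijn indices). -/
inductive Var : Ctx → Ty → Type
  | z {Γ : Ctx} {σ : Ty} : Var (σ :: Γ) σ
  | s {Γ : Ctx} {σ ρ : Ty} : Var Γ σ → Var (ρ :: Γ) σ

/-- The constants of the language: zero, successor, the two combinators, the recursor for numbers,
the empty sequence, the operation that puts an element in front of a sequence, and the recursor for
sequences. -/
inductive Cst : Ty → Type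
  | zero : Cst Ty.nat
  | succ : Cst (Ty.nat ⇒ Ty.nat)
  | proj (σ τ : Ty) : Cst (σ ⇒ τ ⇒ σ)
  | comb (ρ σ τ : Ty) : Cst ((ρ ⇒ σ ⇒ τ) ⇒ (ρ ⇒ σ) ⇒ ρ ⇒ τ)
  | recN (ρ : Ty) : Cst (Ty.nat ⇒ ρ ⇒ (ρ ⇒ Ty.nat ⇒ ρ) ⇒ ρ)
  | nil (σ : Ty) : Cst (Ty.seq σ)
  | cons (σ : Ty) : Cst (σ ⇒ Ty.seq σ ⇒ Ty.seq σ)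
  | recL (σ ρ : Ty) : Cst (Ty.seq σ ⇒ ρ ⇒ (ρ ⇒ σ ⇒ ρ) ⇒ ρ)

/-- Terms of type `σ` with free variables in a context. -/
inductive Tm (Γ : Ctx) : Ty → Type
  | var {σ : Ty} : Var Γ σ → Tm Γ σ
  | cst {σ : Ty} : Cst σ → Tm Γ σ
  | app {σ τ : Ty} : Tm Γ (σ ⇒ τ) → Tm Γ σ → Tm Γ τ

infixl:80 " ⬝ " => Tm.app

/-- Renamings of variables. -/
abbrev Ren (Γ Δ : Ctx) : Type := ∀ σ : Ty, Var Γ σ → Var Δ σ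

/-- Simultaneous substitutions. -/
abbrev Sub (Γ Δ : Ctx) : Type := ∀ σ : Ty, Var Γ σ → Tm Δ σ

def Ren.wk {Γ : Ctx} {ρ : Ty} : Ren Γ (ρ :: Γ) := fun _ v => Var.s v

def Ren.lift {Γ Δ : Ctx} {ρ : Ty} (r : Ren Γ Δ) : Ren (ρ :: Γ) (ρ :: Δ)
  | _, Var.z => Var.z
  | _, Var.s v => Var.s (r _ v)

def Tm.rename {Γ Δ : Ctx} (r : Ren Γ Δ) : {σ : Ty} → Tm Γ σ → Tm Δ σ
  | _, Tm.var v => Tm.var (r _ v)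
  | _, Tm.cst c => Tm.cst c
  | _, Tm.app t u => Tm.app (t.rename r) (u.rename r)

/-- Weakening by one fresh variable. -/
def Tm.wk {Γ : Ctx} {ρ σ : Ty} (t : Tm Γ σ) : Tm (ρ :: Γ) σ := t.rename Ren.wk

def Tm.subst {Γ Δ : Ctx} (θ : Sub Γ Δ) : {σ : Ty} → Tm Γ σ → Tm Δ σ
  | _, Tm.var v => θ _ v
  | _, Tm.cst c => Tm.cst c
  | _, Tm.app t u => Tm.app (t.subst θ) (u.subst θ)

/-- The substitution that replaces variable `0` by `t` and each other variable as `θ` does. -/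
def Sub.cons {Γ Δ : Ctx} {ρ : Ty} (t : Tm Δ ρ) (θ : Sub Γ Δ) : Sub (ρ :: Γ) Δ
  | _, Var.z => t
  | _, Var.s v => θ _ v

def Sub.lift {Γ Δ : Ctx} {ρ : Ty} (θ : Sub Γ Δ) : Sub (ρ :: Γ) (ρ :: Δ) :=
  Sub.cons (Tm.var Var.z) (fun _ v => (θ _ v).wk)

/-- A closed term, regarded as a term in any context. -/
def Tm.ofClosed {Γ : Ctx} {σ : Ty} (t : Tm [] σ) : Tm Γ σ := t.rename (fun _ v => by cases v)

/-- Abstraction `λ x. t` of variable `0`, through the combinators. -/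
def Tm.lam {Γ : Ctx} {σ : Ty} : {τ : Ty} → Tm (σ :: Γ) τ → Tm Γ (σ ⇒ τ)
  | _, Tm.var Var.z =>
      Tm.cst (Cst.comb σ (σ ⇒ σ) σ) ⬝ Tm.cst (Cst.proj σ (σ ⇒ σ)) ⬝ Tm.cst (Cst.proj σ σ)
  | τ, Tm.var (Var.s v) => Tm.cst (Cst.proj τ σ) ⬝ Tm.var v
  | τ, Tm.cst c => Tm.cst (Cst.proj τ σ) ⬝ Tm.cst c
  | τ, Tm.app (σ := ρ) t u => Tm.cst (Cst.comb σ ρ τ) ⬝ t.lam ⬝ u.lam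

section Variables

variable {Γ : Ctx} {a b c d e f : Ty}

def v0 : Tm (a :: Γ) a := Tm.var Var.z
def v1 : Tm (a :: b :: Γ) b := Tm.var (Var.s Var.z)
def v2 : Tm (a :: b :: c :: Γ) c := Tm.var (Var.s (Var.s Var.z))
def v3 : Tm (a :: b :: c :: d :: Γ) d := Tm.var (Var.s (Var.s (Var.s Var.z)))
def v4 : Tm (a :: b :: c :: d :: e :: Γ) e := Tm.var (Var.s (Var.s (Var.s (Var.s Var.z))))
def v5 : Tm (a :: b :: c :: d :: e :: f :: Γ) f :=
  Tm.var (Var.s (Var.s (Var.s (Var.s (Var.s Var.z)))))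

end Variables

/-! ### Arithmetical and sequence operations, as closed terms applied to arguments -/

def zero {Γ : Ctx} : Tm Γ Ty.nat := Tm.cst Cst.zero

def suc {Γ : Ctx} (n : Tm Γ Ty.nat) : Tm Γ Ty.nat := Tm.cst Cst.succ ⬝ n

def nil {Γ : Ctx} {σ : Ty} : Tm Γ (Ty.seq σ) := Tm.cst (Cst.nil σ)

def cons {Γ : Ctx} {σ : Ty} (x : Tm Γ σ) (s : Tm Γ (Ty.seq σ)) : Tm Γ (Ty.seq σ) :=
  Tm.cst (Cst.cons σ) ⬝ x ⬝ s

/-- `natRec n y z` is `y` for `n = 0`, and `natRec (n+1) y z = z (natRec n y z) n`. -/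
def natRec {Γ : Ctx} {ρ : Ty} (n : Tm Γ Ty.nat) (y : Tm Γ ρ) (z : Tm Γ (ρ ⇒ Ty.nat ⇒ ρ)) :
    Tm Γ ρ :=
  Tm.cst (Cst.recN ρ) ⬝ n ⬝ y ⬝ z

/-- `seqRec s y z` is `y` for the empty sequence, and
`seqRec (cons a s) y z = z (seqRec s y z) a`. -/
def seqRec {Γ : Ctx} {σ ρ : Ty} (s : Tm Γ (Ty.seq σ)) (y : Tm Γ ρ) (z : Tm Γ (ρ ⇒ σ ⇒ ρ)) :
    Tm Γ ρ :=
  Tm.cst (Cst.recL σ ρ) ⬝ s ⬝ y ⬝ z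

def predC : Tm [] (Ty.nat ⇒ Ty.nat) := Tm.lam (natRec v0 zero (Tm.lam (Tm.lam v0)))

def subC : Tm [] (Ty.nat ⇒ Ty.nat ⇒ Ty.nat) :=
  Tm.lam (Tm.lam (natRec v0 v1 (Tm.lam (Tm.lam (predC.ofClosed ⬝ v1)))))

/-- Cut-off subtraction `m ∸ n`. -/
def sub {Γ : Ctx} (m n : Tm Γ Ty.nat) : Tm Γ Ty.nat := subC.ofClosed ⬝ m ⬝ n

def iteC (ρ : Ty) : Tm [] (Ty.nat ⇒ ρ ⇒ ρ ⇒ ρ) :=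
  Tm.lam (Tm.lam (Tm.lam (natRec v2 v1 (Tm.lam (Tm.lam v2)))))

/-- `x` if `m ≤ n`, and `y` otherwise. -/
def ifLe {Γ : Ctx} {ρ : Ty} (m n : Tm Γ Ty.nat) (x y : Tm Γ ρ) : Tm Γ ρ :=
  (iteC ρ).ofClosed ⬝ sub m n ⬝ x ⬝ y

/-- The zero object of each type. -/
def zeroOf : (σ : Ty) → Tm [] σ
  | Ty.nat => zero
  | Ty.arr σ τ => Tm.cst (Cst.proj τ σ) ⬝ zeroOf τ
  | Ty.seq _ => nil

def lenC (σ : Ty) : Tm [] (Ty.seq σ ⇒ Ty.nat) :=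
  Tm.lam (seqRec v0 zero (Tm.lam (Tm.lam (suc v1))))

/-- The length `|s|`. -/
def len {Γ : Ctx} {σ : Ty} (s : Tm Γ (Ty.seq σ)) : Tm Γ Ty.nat := (lenC σ).ofClosed ⬝ s

def shiftC (σ : Ty) : Tm [] (σ ⇒ (Ty.nat ⇒ σ) ⇒ Ty.nat ⇒ σ) :=
  Tm.lam (Tm.lam (Tm.lam (natRec v0 v2 (Tm.lam (Tm.lam (v3 ⬝ v0))))))

/-- The infinite sequence `x * α`: first `x`, then the entries of `α`. -/
def shift {Γ : Ctx} {σ : Ty} (x : Tm Γ σ) (α : Tm Γ (Ty.nat ⇒ σ)) : Tm Γ (Ty.nat ⇒ σ) :=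
  (shiftC σ).ofClosed ⬝ x ⬝ α

def preC (σ : Ty) : Tm [] (Ty.seq σ ⇒ (Ty.nat ⇒ σ) ⇒ Ty.nat ⇒ σ) :=
  Tm.lam (Tm.lam (seqRec v1 v0 (Tm.lam (Tm.lam (shift v0 v1)))))

/-- The infinite sequence `s * α`, for a finite sequence `s`. -/
def pre {Γ : Ctx} {σ : Ty} (s : Tm Γ (Ty.seq σ)) (α : Tm Γ (Ty.nat ⇒ σ)) : Tm Γ (Ty.nat ⇒ σ) :=
  (preC σ).ofClosed ⬝ s ⬝ α

/-- The entry `s(i)`; it is the zero object if `i ≥ |s|`. -/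
def get {Γ : Ctx} {σ : Ty} (s : Tm Γ (Ty.seq σ)) (i : Tm Γ Ty.nat) : Tm Γ σ :=
  pre s (zeroOf (Ty.nat ⇒ σ)).ofClosed ⬝ i

def snocC (σ : Ty) : Tm [] (Ty.seq σ ⇒ σ ⇒ Ty.seq σ) :=
  Tm.lam (Tm.lam (seqRec v1 (cons v0 nil) (Tm.lam (Tm.lam (cons v0 v1)))))

/-- The finite sequence `s * ⟨x⟩`. -/
def snoc {Γ : Ctx} {σ : Ty} (s : Tm Γ (Ty.seq σ)) (x : Tm Γ σ) : Tm Γ (Ty.seq σ) :=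
  (snocC σ).ofClosed ⬝ s ⬝ x

/-- The infinite sequence `00…`. -/
def zeros {Γ : Ctx} : Tm Γ ty1 := (zeroOf ty1).ofClosed

def truncC : Tm [] (natSeq ⇒ Ty.nat ⇒ ty1) :=
  Tm.lam (Tm.lam (Tm.lam (ifLe v0 v1 (get v2 v0) zero)))

/-- The infinite sequence `s(0) * … * s(M) * 00…`. -/
def trunc {Γ : Ctx} (s : Tm Γ natSeq) (M : Tm Γ Ty.nat) : Tm Γ ty1 := truncC.ofClosed ⬝ s ⬝ M

/-! ### Formulas -/

/-- Formulas of the language with the standardness predicate.  The logic is classical, and the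
remaining connectives are defined from these. -/
inductive Fm : Ctx → Type
  | eq {Γ : Ctx} {σ : Ty} : Tm Γ σ → Tm Γ σ → Fm Γ
  | st {Γ : Ctx} {σ : Ty} : Tm Γ σ → Fm Γ
  | bot {Γ : Ctx} : Fm Γ
  | imp {Γ : Ctx} : Fm Γ → Fm Γ → Fm Γ
  | all {Γ : Ctx} (σ : Ty) : Fm (σ :: Γ) → Fm Γ

infix:50 " ≐ " => Fm.eq
infixr:25 " ⇾ " => Fm.imp

def Fm.rename : {Γ Δ : Ctx} → Ren Γ Δ → Fm Γ → Fm Δ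
  | _, _, r, Fm.eq t u => Fm.eq (t.rename r) (u.rename r)
  | _, _, r, Fm.st t => Fm.st (t.rename r)
  | _, _, _, Fm.bot => Fm.bot
  | _, _, r, Fm.imp A B => Fm.imp (A.rename r) (B.rename r)
  | _, _, r, Fm.all σ A => Fm.all σ (A.rename r.lift)

def Fm.wk {Γ : Ctx} {ρ : Ty} (A : Fm Γ) : Fm (ρ :: Γ) := A.rename Ren.wk

def Fm.subst : {Γ Δ : Ctx} → Sub Γ Δ → Fm Γ → Fm Δ
  | _, _, θ, Fm.eq t u => Fm.eq (t.subst θ) (u.subst θ)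
  | _, _, θ, Fm.st t => Fm.st (t.subst θ)
  | _, _, _, Fm.bot => Fm.bot
  | _, _, θ, Fm.imp A B => Fm.imp (A.subst θ) (B.subst θ)
  | _, _, θ, Fm.all σ A => Fm.all σ (A.subst θ.lift)

/-- `A[t]`, for a term `t` in place of variable `0`. -/
def Fm.inst {Γ : Ctx} {ρ : Ty} (A : Fm (ρ :: Γ)) (t : Tm Γ ρ) : Fm Γ :=
  A.subst (Sub.cons t (fun _ v => Tm.var v))

/-- Internal formulas: those without the standardness predicate. -/
def Fm.Internal : {Γ : Ctx} → Fm Γ → Prop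
  | _, Fm.eq _ _ => True
  | _, Fm.st _ => False
  | _, Fm.bot => True
  | _, Fm.imp A B => A.Internal ∧ B.Internal
  | _, Fm.all _ A => A.Internal

def Fm.neg {Γ : Ctx} (A : Fm Γ) : Fm Γ := A ⇾ Fm.bot

def Fm.and {Γ : Ctx} (A B : Fm Γ) : Fm Γ := (A ⇾ B.neg).neg

def Fm.or {Γ : Ctx} (A B : Fm Γ) : Fm Γ := A.neg ⇾ B

def Fm.ex {Γ : Ctx} (σ : Ty) (A : Fm (σ :: Γ)) : Fm Γ := (Fm.all σ A.neg).neg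

/-- The quantifier `∀ˢᵗ`. -/
def Fm.allSt {Γ : Ctx} (σ : Ty) (A : Fm (σ :: Γ)) : Fm Γ := Fm.all σ (Fm.st v0 ⇾ A)

/-- The quantifier `∃ˢᵗ`. -/
def Fm.exSt {Γ : Ctx} (σ : Ty) (A : Fm (σ :: Γ)) : Fm Γ := Fm.ex σ ((Fm.st v0).and A)

/-- The quantifier `∀ N ∈ Ω`, over the nonstandard numbers. -/
def Fm.allInf {Γ : Ctx} (A : Fm (Ty.nat :: Γ)) : Fm Γ := Fm.all Ty.nat ((Fm.st v0).neg ⇾ A)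

/-- `m ≤ n`. -/
def le {Γ : Ctx} (m n : Tm Γ Ty.nat) : Fm Γ := sub m n ≐ zero

/-- `m < n`. -/
def lt {Γ : Ctx} (m n : Tm Γ Ty.nat) : Fm Γ := le (suc m) n

/-- `x ∈ s`, that is, `s(i) = x` for some `i < |s|`. -/
def mem {Γ : Ctx} {σ : Ty} (x : Tm Γ σ) (s : Tm Γ (Ty.seq σ)) : Fm Γ :=
  Fm.ex Ty.nat ((lt v0 (len s.wk)).and (get s.wk v0 ≐ x.wk))

/-! ### The axioms of `P` -/

/-- The axioms of `P`.  Schemas may have parameters, namely the variables of the context. -/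
inductive Axm : {Γ : Ctx} → Fm Γ → Prop
  | proj {Γ : Ctx} {σ τ : Ty} (x : Tm Γ σ) (y : Tm Γ τ) :
      Axm (Tm.cst (Cst.proj σ τ) ⬝ x ⬝ y ≐ x)
  | comb {Γ : Ctx} {ρ σ τ : Ty} (x : Tm Γ (ρ ⇒ σ ⇒ τ)) (y : Tm Γ (ρ ⇒ σ)) (z : Tm Γ ρ) :
      Axm (Tm.cst (Cst.comb ρ σ τ) ⬝ x ⬝ y ⬝ z ≐ x ⬝ z ⬝ (y ⬝ z))
  | natRec_zero {Γ : Ctx} {ρ : Ty} (y : Tm Γ ρ) (z : Tm Γ (ρ ⇒ Ty.nat ⇒ ρ)) :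
      Axm (natRec zero y z ≐ y)
  | natRec_suc {Γ : Ctx} {ρ : Ty} (n : Tm Γ Ty.nat) (y : Tm Γ ρ) (z : Tm Γ (ρ ⇒ Ty.nat ⇒ ρ)) :
      Axm (natRec (suc n) y z ≐ z ⬝ natRec n y z ⬝ n)
  | seqRec_nil {Γ : Ctx} {σ ρ : Ty} (y : Tm Γ ρ) (z : Tm Γ (ρ ⇒ σ ⇒ ρ)) :
      Axm (seqRec nil y z ≐ y)
  | seqRec_cons {Γ : Ctx} {σ ρ : Ty} (a : Tm Γ σ) (s : Tm Γ (Ty.seq σ)) (y : Tm Γ ρ)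
      (z : Tm Γ (ρ ⇒ σ ⇒ ρ)) :
      Axm (seqRec (cons a s) y z ≐ z ⬝ seqRec s y z ⬝ a)
  /-- Every finite sequence is empty or has a first element. -/
  | seq_cases {Γ : Ctx} {σ : Ty} (s : Tm Γ (Ty.seq σ)) :
      Axm ((s ≐ nil).or (Fm.ex σ (Fm.ex (Ty.seq σ) (s.wk.wk ≐ cons v1 v0))))
  | suc_ne_zero {Γ : Ctx} (n : Tm Γ Ty.nat) : Axm (suc n ≐ zero).neg
  | suc_inj {Γ : Ctx} (m n : Tm Γ Ty.nat) : Axm (suc m ≐ suc n ⇾ m ≐ n)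
  /-- Equality of functions is pointwise equality (the converse holds by the laws of equality). -/
  | ext {Γ : Ctx} {σ τ : Ty} (t u : Tm Γ (σ ⇒ τ)) :
      Axm (Fm.all σ (t.wk ⬝ v0 ≐ u.wk ⬝ v0) ⇾ t ≐ u)
  /-- Induction, for internal formulas. -/
  | ind {Γ : Ctx} (A : Fm (Ty.nat :: Γ)) (hA : A.Internal) :
      Axm ((A.inst zero).and
          (Fm.all Ty.nat (A ⇾ A.subst (Sub.cons (suc v0) (fun _ v => Tm.var (Var.s v))))) ⇾
        Fm.all Ty.nat A)
  | st_eq {Γ : Ctx} {σ : Ty} (x y : Tm Γ σ) : Axm ((Fm.st x).and (x ≐ y) ⇾ Fm.st y)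
  /-- Closed terms are standard. -/
  | st_closed {Γ : Ctx} {σ : Ty} (t : Tm [] σ) : Axm (Fm.st (t.ofClosed : Tm Γ σ))
  | st_app {Γ : Ctx} {σ τ : Ty} (t : Tm Γ (σ ⇒ τ)) (x : Tm Γ σ) :
      Axm ((Fm.st t).and (Fm.st x) ⇾ Fm.st (t ⬝ x))
  /-- External induction, for all formulas. -/
  | ind_st {Γ : Ctx} (A : Fm (Ty.nat :: Γ)) :
      Axm ((A.inst zero).and
          (Fm.allSt Ty.nat (A ⇾ A.subst (Sub.cons (suc v0) (fun _ v => Tm.var (Var.s v))))) ⇾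
        Fm.allSt Ty.nat A)
  /-- Herbrandised choice, for internal `A(x, y)`; in `A`, variable `0` is `y` and variable `1`
  is `x`. -/
  | hac {Γ : Ctx} {ρ τ : Ty} (A : Fm (τ :: ρ :: Γ)) (hA : A.Internal) :
      Axm (Fm.allSt ρ (Fm.exSt τ A) ⇾
        Fm.exSt (ρ ⇒ Ty.seq τ) (Fm.allSt ρ (Fm.ex τ
          ((mem v0 (v2 ⬝ v1)).and (A.rename Ren.wk.lift.lift)))))
  /-- Idealisation, for internal `A(z, y)`; in `A`, variable `0` is `z` and variable `1` is `y`. -/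
  | ideal {Γ : Ctx} {σ τ : Ty} (A : Fm (σ :: τ :: Γ)) (hA : A.Internal) :
      Axm (Fm.allSt (Ty.seq σ) (Fm.ex τ (Fm.all σ
          (mem v0 v2 ⇾ A.rename Ren.wk.lift.lift))) ⇾
        Fm.ex τ (Fm.allSt σ A))

/-! ### Derivations -/

/-- `Derives Δ A`: the formula `A` is derivable in `P` from the hypotheses `Δ`, by natural deduction
for classical many-sorted logic with equality. -/
inductive Derives : {Γ : Ctx} → List (Fm Γ) → Fm Γ → Prop
  | ax {Γ : Ctx} {Δ : List (Fm Γ)} {A : Fm Γ} (h : Axm A) : Derives Δ A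
  | hyp {Γ : Ctx} {Δ : List (Fm Γ)} {A : Fm Γ} (h : A ∈ Δ) : Derives Δ A
  | impI {Γ : Ctx} {Δ : List (Fm Γ)} {A B : Fm Γ} (h : Derives (A :: Δ) B) : Derives Δ (A ⇾ B)
  | impE {Γ : Ctx} {Δ : List (Fm Γ)} {A B : Fm Γ} (h₁ : Derives Δ (A ⇾ B)) (h₂ : Derives Δ A) :
      Derives Δ B
  | contra {Γ : Ctx} {Δ : List (Fm Γ)} {A : Fm Γ} (h : Derives (A.neg :: Δ) Fm.bot) : Derives Δ A
  | allI {Γ : Ctx} {Δ : List (Fm Γ)} {σ : Ty} {A : Fm (σ :: Γ)}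
      (h : Derives (Δ.map Fm.wk) A) : Derives Δ (Fm.all σ A)
  | allE {Γ : Ctx} {Δ : List (Fm Γ)} {σ : Ty} {A : Fm (σ :: Γ)}
      (h : Derives Δ (Fm.all σ A)) (t : Tm Γ σ) : Derives Δ (A.inst t)
  | eqI {Γ : Ctx} {Δ : List (Fm Γ)} {σ : Ty} (t : Tm Γ σ) : Derives Δ (t ≐ t)
  | eqE {Γ : Ctx} {Δ : List (Fm Γ)} {σ : Ty} (A : Fm (σ :: Γ)) {t u : Tm Γ σ}
      (h₁ : Derives Δ (t ≐ u)) (h₂ : Derives Δ (A.inst t)) : Derives Δ (A.inst u)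

/-! ### The two additional principles -/

/-- `f ≈₁ g`: the two functions agree at all standard numbers. -/
def approx {Γ : Ctx} (f g : Tm Γ ty1) : Fm Γ := Fm.allSt Ty.nat (f.wk ⬝ v0 ≐ g.wk ⬝ v0)

/-- `f ≤₁ 1`. -/
def binary {Γ : Ctx} (f : Tm Γ ty1) : Fm Γ := Fm.all Ty.nat (le (f.wk ⬝ v0) (suc zero))

/-- `(f(0), …, f(N)) = (g(0), …, g(N))`. -/
def agree {Γ : Ctx} (f g : Tm Γ ty1) (N : Tm Γ Ty.nat) : Fm Γ :=
  Fm.all Ty.nat (le v0 N.wk ⇾ f.wk ⬝ v0 ≐ g.wk ⬝ v0)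

/-- `Y ∈ C`: for all `f` there is `N` such that for all `g`, if `g` and `f` agree up to `N`, then
`Y(f) = Y(g)`.  This is an internal formula. -/
def cont {Γ : Ctx} (Y : Tm Γ ty2) : Fm Γ :=
  Fm.all ty1 (Fm.ex Ty.nat (Fm.all ty1
    (agree v0 v2 v1 ⇾ Y.wk.wk.wk ⬝ v2 ≐ Y.wk.wk.wk ⬝ v0)))

/-- Nonstandard pointwise continuity: for all standard `Y ∈ C`, all standard `f` and all `g`, if
`f ≈₁ g`, then `Y(f) = Y(g)`. -/
def NPC : Fm [] :=
  Fm.allSt ty2 (cont v0 ⇾ Fm.allSt ty1 (Fm.all ty1 (approx v1 v0 ⇾ v2 ⬝ v1 ≐ v2 ⬝ v0)))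

/-- Standard parts: for every `f ≤₁ 1` there is a standard `g ≤₁ 1` with `f ≈₁ g`. -/
def STP : Fm [] :=
  Fm.all ty1 (binary v0 ⇾ Fm.exSt ty1 ((binary v0).and (approx v1 v0)))

/-! ### The canonical approximations -/

/-- The canonical approximation `G(Y, s, N)`, by recursion on `N ∸ |s|`. -/
def G : Tm [] (ty2 ⇒ natSeq ⇒ Ty.nat ⇒ Ty.nat) :=
  Tm.lam (Tm.lam (Tm.lam (natRec (sub v0 (len v1))
    -- variables: `s`, then those outside
    (Tm.lam (v3 ⬝ pre v0 zeros))
    -- variables: `s`, the counter, the value at the counter, then those outside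
    (Tm.lam (Tm.lam (Tm.lam (v5 ⬝ pre v0 (shift zero (Tm.lam (v3 ⬝ snoc v1 (suc v0))))))))
    ⬝ v1)))

/-- The canonical approximation `H(Y, s, M)`, by recursion on `M ∸ |s|`. -/
def H : Tm [] (ty2 ⇒ natSeq ⇒ Ty.nat ⇒ Ty.nat) :=
  Tm.lam (Tm.lam (Tm.lam (natRec (sub v0 (len v1))
    -- variables: `s`, then those outside
    (Tm.lam (v3 ⬝ trunc v0 v1))
    -- variables: `s`, the counter, the value at the counter, then those outside
    (Tm.lam (Tm.lam (Tm.lam (v5 ⬝ pre v0 (shift zero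
      (Tm.lam (ifLe (suc v0) v4 (v3 ⬝ snoc v1 (suc v0)) zero)))))))
    ⬝ v1)))

/-- `G(Y, s, N)`, for terms `Y`, `s`, `N`. -/
def appG {Γ : Ctx} (Y : Tm Γ ty2) (s : Tm Γ natSeq) (N : Tm Γ Ty.nat) : Tm Γ Ty.nat :=
  G.ofClosed ⬝ Y ⬝ s ⬝ N

/-- `H(Y, s, M)`, for terms `Y`, `s`, `M`. -/
def appH {Γ : Ctx} (Y : Tm Γ ty2) (s : Tm Γ natSeq) (M : Tm Γ Ty.nat) : Tm Γ Ty.nat :=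
  H.ofClosed ⬝ Y ⬝ s ⬝ M

/-- The defining equations of `G`: for all `Y`, `s`, `N`,
if `|s| ≥ N`, then `G(Y, s, N) = Y(s * 00…)`;
otherwise `G(Y, s, N) = Y(s * 0 * (λ n) G(Y, s * (n+1), N))`. -/
def defG : Fm [] :=
  Fm.all ty2 (Fm.all natSeq (Fm.all Ty.nat
    ((le v0 (len v1) ⇾ appG v2 v1 v0 ≐ v2 ⬝ pre v1 zeros).and
     ((le v0 (len v1)).neg ⇾
        appG v2 v1 v0 ≐ v2 ⬝ pre v1 (shift zero (Tm.lam (appG v3 (snoc v2 (suc v0)) v1)))))))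

/-- The defining equations of `H`: for all `Y`, `s`, `M`,
if `|s| ≥ M`, then `H(Y, s, M) = Y(s(0) * … * s(M) * 00…)`;
otherwise `H(Y, s, M) = Y(s * 0 * H(Y, s * 1, M) * … * H(Y, s * M, M) * 00…)`. -/
def defH : Fm [] :=
  Fm.all ty2 (Fm.all natSeq (Fm.all Ty.nat
    ((le v0 (len v1) ⇾ appH v2 v1 v0 ≐ v2 ⬝ trunc v1 v0).and
     ((le v0 (len v1)).neg ⇾
        appH v2 v1 v0 ≐ v2 ⬝ pre v1 (shift zero
          (Tm.lam (ifLe (suc v0) v1 (appH v3 (snoc v2 (suc v0)) v1) zero)))))))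

/-- For all standard `Y ∈ C` and standard `s`, and all `M, N ∈ Ω`: `G(Y, s, N) = G(Y, s, M)`. -/
def invG : Fm [] :=
  Fm.allSt ty2 (cont v0 ⇾ Fm.allSt natSeq (Fm.allInf (Fm.allInf (appG v3 v2 v0 ≐ appG v3 v2 v1))))

/-- For all standard `Y ∈ C` and standard `s`, and all `M, N ∈ Ω`: `H(Y, s, N) = H(Y, s, M)`. -/
def invH : Fm [] :=
  Fm.allSt ty2 (cont v0 ⇾ Fm.allSt natSeq (Fm.allInf (Fm.allInf (appH v3 v2 v0 ≐ appH v3 v2 v1))))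

end PSys

namespace PSys

/-! ### Substitution calculus -/

/-! Derivability is reduced to truth in models: the Henkin construction (`Chain.sat_iff`,
`derives_of_forall_model`) turns a semantic proof into a derivation. Everything afterwards happens
inside one model of `P`, in which a property must be written as a formula before induction, choice
or underspill applies to it.

In a model of NPC with a nonstandard number, underspill gives each standard `Y ∈ C` a standard
modulus of continuity at each standard point (`exists_st_modulus`). Herbrandised choice makes the
modulus at `00…` a standard functional `Ψ`. This yields transfer (`eq_zero_of_forall_st`). Suppose a
standard `d` vanishes at all standard numbers and has exactly one nonzero value, at `w`. Let `p` be
`Ψ` of the constant functional zero, and let `Z(g) = Ψ(λ h. g'(h(p + 1)))`, where `g'` is `g` cut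
down to the support of `d`. Then `Z` depends only on `g` up to `w`, so NPC applies to it, and `d ≈₁
00…` gives `Z(d) = Z(00…) = p`. Hence `p` is a modulus at `00…` of `λ h. d(h(p + 1))`, which is
absurd, as `h(p + 1)` may be changed from `0` to `w`. Transfer and choice together give a standard
search functional `μ` (`exists_st_mu`).

Let `A` be `G Y` or `H Y`, and call `s` stable if `A s N` is constant in `N` from some standard
number on. Through `μ`, standard functions compute limits of stable sequences and find unstable
one-entry extensions. If all `s * (n + 1)` with `n` standard are stable, their limits form a
standard `γ`; NPC gives `A s N = Y(s * 0 * γ)` for all nonstandard `N`, and underspill makes `s`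
stable (`Stable.of_snoc`). So an unstable standard `s` starts a standard path whose members at
standard indices are all unstable. But `Y` has a standard modulus at the limit of the path, and a
member longer than the modulus has the constant value of `Y` at the limit (`exists_stable_path`).
Thus every standard `s` is stable, which gives invariance. -/

def Ren.toSub {Γ Δ : Ctx} (r : Ren Γ Δ) : Sub Γ Δ := fun _ v => Tm.var (r _ v)

def Sub.comp {Γ Δ Ξ : Ctx} (θ : Sub Γ Δ) (η : Sub Δ Ξ) : Sub Γ Ξ := fun _ v => (θ _ v).subst η

/-- With renamings seen as substitutions, commutation laws reduce to composing substitutions and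
comparing them variable by variable. -/
theorem Tm.rename_eq_subst {Γ Δ : Ctx} (r : Ren Γ Δ) {σ : Ty} (t : Tm Γ σ) :
    t.rename r = t.subst r.toSub := by
  induction t with
  | var v => rfl
  | cst c => rfl
  | app t u iht ihu => simp only [Tm.rename, Tm.subst, iht, ihu]

theorem Tm.subst_subst {Γ Δ Ξ : Ctx} (θ : Sub Γ Δ) (η : Sub Δ Ξ) {σ : Ty} (t : Tm Γ σ) :
    (t.subst θ).subst η = t.subst (θ.comp η) := by
  induction t with
  | var v => rfl
  | cst c => rfl
  | app t u iht ihu => simp only [Tm.subst, iht, ihu]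

theorem Tm.subst_var {Γ : Ctx} {σ : Ty} (t : Tm Γ σ) : t.subst (fun _ v => Tm.var v) = t := by
  induction t with
  | var v => rfl
  | cst c => rfl
  | app t u iht ihu => simp only [Tm.subst, iht, ihu]

theorem Sub.ext_cons {Γ Δ : Ctx} {ρ : Ty} {θ η : Sub (ρ :: Γ) Δ} (h0 : θ _ Var.z = η _ Var.z)
    (hs : ∀ σ (v : Var Γ σ), θ _ (Var.s v) = η _ (Var.s v)) : θ = η := by
  funext σ v
  cases v with
  | z => exact h0
  | s v => exact hs _ v

theorem Ren.toSub_lift {Γ Δ : Ctx} {ρ : Ty} (r : Ren Γ Δ) :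
    (r.lift (ρ := ρ)).toSub = r.toSub.lift :=
  Sub.ext_cons rfl fun _ _ => rfl

theorem Tm.wk_subst_lift {Γ Δ : Ctx} {ρ σ : Ty} (t : Tm Γ σ) (θ : Sub Γ Δ) :
    (t.wk (ρ := ρ)).subst θ.lift = (t.subst θ).wk := by
  simp only [Tm.wk, Tm.rename_eq_subst, Tm.subst_subst]
  congr 1
  funext σ v
  show (θ _ v).wk = _
  simp only [Tm.wk, Tm.rename_eq_subst]
  rfl

theorem Tm.wk_subst_cons {Γ Δ : Ctx} {ρ σ : Ty} (t : Tm Γ σ) (u : Tm Δ ρ) (θ : Sub Γ Δ) :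
    (t.wk (ρ := ρ)).subst (Sub.cons u θ) = t.subst θ := by
  simp only [Tm.wk, Tm.rename_eq_subst, Tm.subst_subst]
  rfl

theorem Sub.comp_lift {Γ Δ Ξ : Ctx} {ρ : Ty} (θ : Sub Γ Δ) (η : Sub Δ Ξ) :
    (θ.lift (ρ := ρ)).comp η.lift = (θ.comp η).lift :=
  Sub.ext_cons rfl fun _ v => Tm.wk_subst_lift (θ _ v) η

theorem Sub.lift_var {Γ : Ctx} {ρ : Ty} :
    Sub.lift (ρ := ρ) (fun _ (v : Var Γ _) => Tm.var v) = fun _ v => Tm.var v :=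
  Sub.ext_cons rfl fun _ _ => rfl

theorem Fm.rename_eq_subst {Γ Δ : Ctx} (r : Ren Γ Δ) (A : Fm Γ) :
    A.rename r = A.subst r.toSub := by
  induction A generalizing Δ with
  | eq t u => simp only [Fm.rename, Fm.subst, Tm.rename_eq_subst]
  | st t => simp only [Fm.rename, Fm.subst, Tm.rename_eq_subst]
  | bot => rfl
  | imp A B ihA ihB => simp only [Fm.rename, Fm.subst, ihA, ihB]
  | all σ A ih => simp only [Fm.rename, Fm.subst, ih, Ren.toSub_lift]

theorem Fm.subst_subst {Γ Δ Ξ : Ctx} (θ : Sub Γ Δ) (η : Sub Δ Ξ) (A : Fm Γ) :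
    (A.subst θ).subst η = A.subst (θ.comp η) := by
  induction A generalizing Δ Ξ with
  | eq t u => simp only [Fm.subst, Tm.subst_subst]
  | st t => simp only [Fm.subst, Tm.subst_subst]
  | bot => rfl
  | imp A B ihA ihB => simp only [Fm.subst, ihA, ihB]
  | all σ A ih => simp only [Fm.subst, ih, Sub.comp_lift]

theorem Fm.subst_var {Γ : Ctx} (A : Fm Γ) : A.subst (fun _ v => Tm.var v) = A := by
  induction A with
  | eq t u => simp only [Fm.subst, Tm.subst_var]
  | st t => simp only [Fm.subst, Tm.subst_var]
  | bot => rfl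
  | imp A B ihA ihB => simp only [Fm.subst, ihA, ihB]
  | all σ A ih => simp only [Fm.subst, Sub.lift_var, ih]

theorem Fm.inst_subst {Γ Δ : Ctx} {ρ : Ty} (A : Fm (ρ :: Γ)) (t : Tm Γ ρ) (θ : Sub Γ Δ) :
    (A.inst t).subst θ = (A.subst θ.lift).inst (t.subst θ) := by
  simp only [Fm.inst, Fm.subst_subst]
  congr 1
  refine Sub.ext_cons rfl fun σ v => ?_
  exact ((Tm.wk_subst_cons _ _ _).trans (Tm.subst_var _)).symm

theorem Fm.wk_subst_lift {Γ Δ : Ctx} {ρ : Ty} (A : Fm Γ) (θ : Sub Γ Δ) :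
    (A.wk (ρ := ρ)).subst θ.lift = (A.subst θ).wk := by
  simp only [Fm.wk, Fm.rename_eq_subst, Fm.subst_subst]
  congr 1
  funext σ v
  show (θ _ v).wk = _
  simp only [Tm.wk, Tm.rename_eq_subst]
  rfl

theorem Fm.lift_inst {Γ Δ : Ctx} {ρ : Ty} (A : Fm (ρ :: Γ)) (θ : Sub Γ Δ) (t : Tm Δ ρ) :
    (A.subst θ.lift).inst t = A.subst (Sub.cons t θ) := by
  simp only [Fm.inst, Fm.subst_subst]
  congr 1
  refine Sub.ext_cons rfl fun σ v => ?_
  exact (Tm.wk_subst_cons _ _ _).trans (Tm.subst_var _)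

theorem Fm.rename_lift_inst_var {Γ : Ctx} {ρ : Ty} (A : Fm (ρ :: Γ)) :
    (A.rename Ren.wk.lift).inst (Tm.var Var.z) = A := by
  rw [Fm.rename_eq_subst, Ren.toSub_lift, Fm.lift_inst]
  conv_rhs => rw [← Fm.subst_var A]
  congr 1
  exact Sub.ext_cons rfl fun _ _ => rfl

theorem Tm.ofClosed_subst {Γ Δ : Ctx} {σ : Ty} (t : Tm [] σ) (θ : Sub Γ Δ) :
    (t.ofClosed : Tm Γ σ).subst θ = t.ofClosed := by
  simp only [Tm.ofClosed, Tm.rename_eq_subst, Tm.subst_subst]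
  congr 1
  funext σ v
  cases v

theorem Fm.Internal.subst {Γ Δ : Ctx} {A : Fm Γ} (hA : A.Internal) (θ : Sub Γ Δ) :
    (A.subst θ).Internal := by
  induction A generalizing Δ with
  | eq t u => trivial
  | st t => exact hA
  | bot => trivial
  | imp A B ihA ihB => exact ⟨ihA hA.1 θ, ihB hA.2 θ⟩
  | all σ A ih => exact ih hA θ.lift

theorem Fm.rename_lift_lift_subst {Γ Δ : Ctx} {ρ σ τ : Ty} (A : Fm (τ :: σ :: Γ)) (θ : Sub Γ Δ) :
    (A.rename (Ren.wk (ρ := ρ)).lift.lift).subst θ.lift.lift.lift =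
      (A.subst θ.lift.lift).rename Ren.wk.lift.lift := by
  simp only [Fm.rename_eq_subst, Fm.subst_subst, Ren.toSub_lift, Sub.comp_lift]
  congr 3
  funext σ v
  show (θ _ v).wk = _
  simp only [Tm.wk, Tm.rename_eq_subst]
  rfl

theorem mem_subst {Γ Δ : Ctx} {σ : Ty} (x : Tm Γ σ) (s : Tm Γ (Ty.seq σ)) (θ : Sub Γ Δ) :
    (mem x s).subst θ = mem (x.subst θ) (s.subst θ) := by
  simp only [mem, Fm.ex, Fm.and, Fm.neg, lt, le, sub, len, get, pre, suc, zero, Fm.subst, Tm.subst,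
    Tm.ofClosed_subst, Tm.wk_subst_lift]
  rfl

/-- The axiom schemas carry parameters, so they are closed under substitution. This makes
derivations stable under change of context, and later makes the Henkin model satisfy the axioms. -/
theorem Axm.subst {Γ Δ : Ctx} {A : Fm Γ} (h : Axm A) (θ : Sub Γ Δ) : Axm (A.subst θ) := by
  cases h with
  | proj x y => exact Axm.proj _ _
  | comb x y z => exact Axm.comb _ _ _
  | natRec_zero y z => exact Axm.natRec_zero _ _
  | natRec_suc n y z => exact Axm.natRec_suc _ _ _
  | seqRec_nil y z => exact Axm.seqRec_nil _ _
  | seqRec_cons a s y z => exact Axm.seqRec_cons _ _ _ _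
  | seq_cases s =>
    have := Axm.seq_cases (s.subst θ)
    simp only [← Tm.wk_subst_lift] at this
    exact this
  | suc_ne_zero n => exact Axm.suc_ne_zero _
  | suc_inj m n => exact Axm.suc_inj _ _
  | ext t u =>
    have := Axm.ext (t.subst θ) (u.subst θ)
    simp only [← Tm.wk_subst_lift] at this
    exact this
  | ind A hA =>
    have := Axm.ind (A.subst θ.lift) (hA.subst _)
    have e0 := Fm.inst_subst A zero θ
    have e1 : (A.subst (Sub.cons (suc v0) (fun _ v => Tm.var (Var.s v)))).subst θ.lift =
        (A.subst θ.lift).subst (Sub.cons (suc v0) (fun _ v => Tm.var (Var.s v))) := by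
      simp only [Fm.subst_subst]
      congr 1
      refine Sub.ext_cons rfl fun σ v => ?_
      refine Eq.symm ((Tm.wk_subst_cons _ _ _).trans ?_)
      show _ = (θ _ v).wk
      simp only [Tm.wk, Tm.rename_eq_subst]
      rfl
    simp only [Fm.and, Fm.neg, Fm.subst, e0, e1]
    exact this
  | st_eq x y => exact Axm.st_eq _ _
  | st_closed t =>
    simp only [Fm.subst, Tm.ofClosed_subst]
    exact Axm.st_closed t
  | st_app t x => exact Axm.st_app _ _
  | ind_st A =>
    have := Axm.ind_st (A.subst θ.lift)
    have e0 := Fm.inst_subst A zero θ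
    have e1 : (A.subst (Sub.cons (suc v0) (fun _ v => Tm.var (Var.s v)))).subst θ.lift =
        (A.subst θ.lift).subst (Sub.cons (suc v0) (fun _ v => Tm.var (Var.s v))) := by
      simp only [Fm.subst_subst]
      congr 1
      refine Sub.ext_cons rfl fun σ v => ?_
      refine Eq.symm ((Tm.wk_subst_cons _ _ _).trans ?_)
      show _ = (θ _ v).wk
      simp only [Tm.wk, Tm.rename_eq_subst]
      rfl
    simp only [Fm.and, Fm.allSt, Fm.neg, Fm.subst, e0, e1]
    exact this
  | hac A hA =>
    have := Axm.hac (A.subst θ.lift.lift) (hA.subst _)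
    rw [← Fm.rename_lift_lift_subst] at this
    simp only [Fm.and, Fm.allSt, Fm.exSt, Fm.ex, Fm.neg, Fm.subst, mem_subst]
    exact this
  | ideal A hA =>
    have := Axm.ideal (A.subst θ.lift.lift) (hA.subst _)
    rw [← Fm.rename_lift_lift_subst] at this
    simp only [Fm.allSt, Fm.ex, Fm.neg, Fm.subst, mem_subst]
    exact this

theorem Derives.mono {Γ : Ctx} {Δ Δ' : List (Fm Γ)} {A : Fm Γ} (h : Derives Δ A) (hs : Δ ⊆ Δ') :
    Derives Δ' A := by
  induction h with
  | ax h => exact Derives.ax h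
  | hyp h => exact Derives.hyp (hs h)
  | impI _ ih => exact Derives.impI (ih (List.cons_subset_cons _ hs))
  | impE _ _ ih₁ ih₂ => exact Derives.impE (ih₁ hs) (ih₂ hs)
  | contra _ ih => exact Derives.contra (ih (List.cons_subset_cons _ hs))
  | allI _ ih => exact Derives.allI (ih (List.map_subset _ hs))
  | allE _ t ih => exact Derives.allE (ih hs) t
  | eqI t => exact Derives.eqI t
  | eqE A _ _ ih₁ ih₂ => exact Derives.eqE A (ih₁ hs) (ih₂ hs)

theorem Derives.subst {Γ Δ : Ctx} {Ξ : List (Fm Γ)} {A : Fm Γ} (h : Derives Ξ A) (θ : Sub Γ Δ) :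
    Derives (Ξ.map (Fm.subst θ)) (A.subst θ) := by
  induction h generalizing Δ with
  | ax h => exact Derives.ax (h.subst θ)
  | hyp h => exact Derives.hyp (List.mem_map_of_mem h)
  | impI _ ih => exact Derives.impI (ih θ)
  | impE _ _ ih₁ ih₂ => exact Derives.impE (ih₁ θ) (ih₂ θ)
  | contra _ ih => exact Derives.contra (ih θ)
  | allI _ ih =>
    refine Derives.allI ?_
    have := ih θ.lift
    simp only [List.map_map] at this ⊢
    convert this using 2
    funext B
    exact (Fm.wk_subst_lift B θ).symm
  | allE _ t ih =>
    rw [Fm.inst_subst]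
    exact Derives.allE (ih θ) _
  | eqI t => exact Derives.eqI _
  | eqE A _ _ ih₁ ih₂ =>
    have h₂ := ih₂ θ
    rw [Fm.inst_subst] at h₂ ⊢
    exact Derives.eqE _ (ih₁ θ) h₂

theorem Derives.rename {Γ Δ : Ctx} {Ξ : List (Fm Γ)} {A : Fm Γ} (h : Derives Ξ A) (r : Ren Γ Δ) :
    Derives (Ξ.map (Fm.rename r)) (A.rename r) := by
  have e : (Fm.rename r : Fm Γ → Fm Δ) = Fm.subst r.toSub := funext fun A => A.rename_eq_subst r
  rw [e]
  exact h.subst _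

/-! ### Countability of the language -/

def Ty.depth : Ty → ℕ
  | Ty.nat => 0
  | Ty.arr σ τ => max σ.depth τ.depth + 1
  | Ty.seq σ => σ.depth + 1

instance Ty.countable : Countable Ty := by
  have key : ∀ n, {σ : Ty | σ.depth ≤ n}.Countable := by
    intro n
    induction n with
    | zero =>
      refine (Set.countable_singleton Ty.nat).mono ?_
      rintro (_ | _ | _) h <;> simp [Ty.depth] at h ⊢
    | succ n ih =>
      refine ((Set.countable_singleton Ty.nat).union
        ((ih.image2 ih Ty.arr).union (ih.image Ty.seq))).mono ?_
      rintro (_ | ⟨σ, τ⟩ | σ) h <;> simp [Ty.depth] at h ⊢ <;> exact h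
  rw [← Set.countable_univ_iff]
  exact (Set.countable_iUnion key).mono fun σ _ => Set.mem_iUnion.2 ⟨σ.depth, by simp⟩

instance Var.countable_sigma (Γ : Ctx) : Countable (Σ σ, Var Γ σ) := by
  induction Γ with
  | nil => exact ⟨fun _ => 0, fun ⟨_, v⟩ => by cases v⟩
  | cons ρ Γ ih =>
    let f : Option (Σ σ, Var Γ σ) → Σ σ, Var (ρ :: Γ) σ
      | none => ⟨ρ, Var.z⟩
      | some ⟨σ, v⟩ => ⟨σ, Var.s v⟩
    refine Function.Surjective.countable (f := f) ?_
    rintro ⟨σ, v⟩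
    cases v with
    | z => exact ⟨none, rfl⟩
    | s v => exact ⟨some ⟨σ, v⟩, rfl⟩

instance Var.countable (Γ : Ctx) (σ : Ty) : Countable (Var Γ σ) :=
  Function.Injective.countable (f := fun v => (⟨σ, v⟩ : Σ σ, Var Γ σ)) sigma_mk_injective

instance Cst.countable_sigma : Countable (Σ σ, Cst σ) := by
  let f : ℕ × Ty × Ty × Ty → Σ σ, Cst σ
    | (0, _) => ⟨_, Cst.zero⟩
    | (1, _) => ⟨_, Cst.succ⟩
    | (2, σ, τ, _) => ⟨_, Cst.proj σ τ⟩
    | (3, ρ, σ, τ) => ⟨_, Cst.comb ρ σ τ⟩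
    | (4, ρ, _) => ⟨_, Cst.recN ρ⟩
    | (5, σ, _) => ⟨_, Cst.nil σ⟩
    | (6, σ, _) => ⟨_, Cst.cons σ⟩
    | (_, σ, ρ, _) => ⟨_, Cst.recL σ ρ⟩
  refine Function.Surjective.countable (f := f) ?_
  rintro ⟨_, c⟩
  cases c with
  | zero => exact ⟨(0, Ty.nat, Ty.nat, Ty.nat), rfl⟩
  | succ => exact ⟨(1, Ty.nat, Ty.nat, Ty.nat), rfl⟩
  | proj σ τ => exact ⟨(2, σ, τ, Ty.nat), rfl⟩
  | comb ρ σ τ => exact ⟨(3, ρ, σ, τ), rfl⟩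
  | recN ρ => exact ⟨(4, ρ, Ty.nat, Ty.nat), rfl⟩
  | nil σ => exact ⟨(5, σ, Ty.nat, Ty.nat), rfl⟩
  | cons σ => exact ⟨(6, σ, Ty.nat, Ty.nat), rfl⟩
  | recL σ ρ => exact ⟨(7, σ, ρ, Ty.nat), rfl⟩

instance Cst.countable (σ : Ty) : Countable (Cst σ) :=
  Function.Injective.countable (f := fun c => (⟨σ, c⟩ : Σ σ, Cst σ)) sigma_mk_injective

def Tm.depth {Γ : Ctx} : {σ : Ty} → Tm Γ σ → ℕ
  | _, Tm.var _ => 0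
  | _, Tm.cst _ => 0
  | _, Tm.app t u => max t.depth u.depth + 1

/-- An application hides the type of its argument, so the terms of depth at most `n + 1` are covered
by the atoms and a union over the countably many possible types; the induction on depth runs over
all types at once. -/
instance Tm.countable (Γ : Ctx) (σ : Ty) : Countable (Tm Γ σ) := by
  have base : ∀ σ, (Set.range (Tm.var : Var Γ σ → Tm Γ σ) ∪
      Set.range (Tm.cst : Cst σ → Tm Γ σ)).Countable :=
    fun σ => (Set.countable_range _).union (Set.countable_range _)
  have key : ∀ n, ∀ σ, {t : Tm Γ σ | t.depth ≤ n}.Countable := by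
    intro n
    induction n with
    | zero =>
      intro σ
      refine (base σ).mono ?_
      rintro (_ | _ | _) h <;> simp [Tm.depth] at h ⊢
    | succ n ih =>
      intro σ
      refine ((base σ).union (Set.countable_iUnion fun ρ =>
        (ih (ρ ⇒ σ)).image2 (ih ρ) Tm.app)).mono ?_
      rintro (v | c | ⟨t, u⟩) h
      · simp
      · simp
      · simp only [Tm.depth, Set.mem_ofPred_eq, Nat.add_le_add_iff_right, max_le_iff] at h
        exact Or.inr (Set.mem_iUnion.2 ⟨_, Set.mem_image2_of_mem h.1 h.2⟩)
  rw [← Set.countable_univ_iff]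
  exact (Set.countable_iUnion fun n => key n σ).mono fun t _ => Set.mem_iUnion.2 ⟨t.depth, by simp⟩

def Fm.depth : {Γ : Ctx} → Fm Γ → ℕ
  | _, Fm.eq _ _ => 0
  | _, Fm.st _ => 0
  | _, Fm.bot => 0
  | _, Fm.imp A B => max A.depth B.depth + 1
  | _, Fm.all _ A => A.depth + 1

/-- The induction on depth runs over all contexts at once, because a quantifier enlarges the context
of its body. -/
instance Fm.countable (Γ : Ctx) : Countable (Fm Γ) := by
  have atoms : ∀ Γ : Ctx, ((⋃ σ, Set.image2 (Fm.eq (Γ := Γ) (σ := σ)) Set.univ Set.univ) ∪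
      ((⋃ σ, Set.range (Fm.st (Γ := Γ) (σ := σ))) ∪ {Fm.bot})).Countable := fun Γ =>
    (Set.countable_iUnion fun σ => Set.countable_univ.image2 Set.countable_univ _).union
      ((Set.countable_iUnion fun σ => Set.countable_range _).union (Set.countable_singleton _))
  have key : ∀ n, ∀ Γ, {A : Fm Γ | A.depth ≤ n}.Countable := by
    intro n
    induction n with
    | zero =>
      intro Γ
      refine (atoms Γ).mono ?_
      rintro (_ | _ | _ | _ | _) h <;> simp [Fm.depth] at h ⊢
    | succ n ih =>
      intro Γ
      refine ((atoms Γ).union (((ih Γ).image2 (ih Γ) Fm.imp).union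
        (Set.countable_iUnion fun σ => (ih (σ :: Γ)).image (Fm.all σ)))).mono ?_
      rintro (_ | _ | _ | ⟨A, B⟩ | ⟨σ, A⟩) h
      · exact Or.inl (Or.inl (Set.mem_iUnion.2 ⟨_, Set.mem_image2_of_mem trivial trivial⟩))
      · exact Or.inl (Or.inr (Or.inl (Set.mem_iUnion.2 ⟨_, Set.mem_range_self _⟩)))
      · exact Or.inl (Or.inr (Or.inr rfl))
      · simp only [Fm.depth, Set.mem_ofPred_eq, Nat.add_le_add_iff_right, max_le_iff] at h
        exact Or.inr (Or.inl (Set.mem_image2_of_mem h.1 h.2))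
      · simp only [Fm.depth, Set.mem_ofPred_eq, Nat.add_le_add_iff_right] at h
        exact Or.inr (Or.inr (Set.mem_iUnion.2 ⟨σ, Set.mem_image_of_mem _ h⟩))
  rw [← Set.countable_univ_iff]
  exact (Set.countable_iUnion fun n => key n Γ).mono fun t _ => Set.mem_iUnion.2 ⟨t.depth, by simp⟩

/-! ### Derived rules -/

theorem Derives.botE {Γ : Ctx} {Δ : List (Fm Γ)} {A : Fm Γ} (h : Derives Δ Fm.bot) : Derives Δ A :=
  Derives.contra (h.mono (List.subset_cons_self _ _))

theorem Derives.eq_symm {Γ : Ctx} {Δ : List (Fm Γ)} {σ : Ty} {t u : Tm Γ σ}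
    (h : Derives Δ (t ≐ u)) : Derives Δ (u ≐ t) := by
  have := Derives.eqE (v0 ≐ t.wk) h
  simp only [Fm.inst, Fm.subst, Tm.wk_subst_cons, Tm.subst_var] at this
  exact this (Derives.eqI t)

theorem Derives.eq_trans {Γ : Ctx} {Δ : List (Fm Γ)} {σ : Ty} {t u w : Tm Γ σ}
    (h : Derives Δ (t ≐ u)) (h' : Derives Δ (u ≐ w)) : Derives Δ (t ≐ w) := by
  have := Derives.eqE (t.wk ≐ v0) h'
  simp only [Fm.inst, Fm.subst, Tm.wk_subst_cons, Tm.subst_var] at this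
  exact this h

theorem Derives.eq_app {Γ : Ctx} {Δ : List (Fm Γ)} {σ τ : Ty} {t t' : Tm Γ (σ ⇒ τ)} {u u' : Tm Γ σ}
    (h : Derives Δ (t ≐ t')) (h' : Derives Δ (u ≐ u')) : Derives Δ (t ⬝ u ≐ t' ⬝ u') := by
  have h₁ := Derives.eqE (t.wk ⬝ u.wk ≐ v0 ⬝ u.wk) h
  have h₂ := Derives.eqE (t'.wk ⬝ u.wk ≐ t'.wk ⬝ v0) h'
  simp only [Fm.inst, Fm.subst, Tm.subst, Tm.wk_subst_cons, Tm.subst_var] at h₁ h₂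
  exact (h₁ (Derives.eqI _)).eq_trans (h₂ (Derives.eqI _))

theorem Derives.st_congr {Γ : Ctx} {Δ : List (Fm Γ)} {σ : Ty} {t u : Tm Γ σ}
    (h : Derives Δ (t ≐ u)) (h' : Derives Δ (Fm.st t)) : Derives Δ (Fm.st u) :=
  Derives.eqE (Fm.st v0) h h'

/-! ### Structures and satisfaction -/

/-- A structure for the language, in which equality is interpreted as equality. -/
structure Str where
  C : Ty → Type
  app : {σ τ : Ty} → C (σ ⇒ τ) → C σ → C τ
  cst : {σ : Ty} → Cst σ → C σ
  st : {σ : Ty} → C σ → Prop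

abbrev Env (M : Str) (Γ : Ctx) : Type := ∀ σ : Ty, Var Γ σ → M.C σ

def Env.cons {M : Str} {Γ : Ctx} {ρ : Ty} (a : M.C ρ) (e : Env M Γ) : Env M (ρ :: Γ)
  | _, Var.z => a
  | _, Var.s v => e _ v

def Env.nil {M : Str} : Env M [] := fun _ v => by cases v

def Tm.val {M : Str} {Γ : Ctx} (e : Env M Γ) : {σ : Ty} → Tm Γ σ → M.C σ
  | _, Tm.var v => e _ v
  | _, Tm.cst c => M.cst c
  | _, Tm.app t u => M.app (t.val e) (u.val e)

def Fm.Sat {M : Str} : {Γ : Ctx} → Env M Γ → Fm Γ → Prop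
  | _, e, Fm.eq t u => t.val e = u.val e
  | _, e, Fm.st t => M.st (t.val e)
  | _, _, Fm.bot => False
  | _, e, Fm.imp A B => A.Sat e → B.Sat e
  | _, e, Fm.all σ A => ∀ a : M.C σ, A.Sat (Env.cons a e)

/-- The structure satisfies the axioms of `P`. -/
class Str.IsModel (M : Str) : Prop where
  sat : ∀ {Γ : Ctx} {A : Fm Γ}, Axm A → ∀ e : Env M Γ, A.Sat e

/-! ### The Henkin construction -/

def Sub.empty {Δ : Ctx} : Sub [] Δ := fun _ v => by cases v

theorem Fm.subst_nil (A : Fm []) (θ : Sub [] []) : A.subst θ = A := by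
  conv_rhs => rw [← Fm.subst_var A]
  congr 1
  funext σ v
  cases v

/-- A consistent finite set of formulas in a context, together with a list of lists of formulas
still to be decided. -/
structure Stage where
  Γ : Ctx
  Δ : List (Fm Γ)
  cons : ¬ Derives Δ Fm.bot
  todo : ℕ → ℕ → Fm Γ

/-- One of `A` and its negation can be added consistently. When a universal formula is refuted, a
fresh variable joins the context as its counterexample; no new constants are needed. -/
theorem Stage.exists_decide {Γ : Ctx} {Δ : List (Fm Γ)} (h : ¬ Derives Δ Fm.bot) (A : Fm Γ) :
    ∃ (Γ' : Ctx) (r : Ren Γ Γ') (Δ' : List (Fm Γ')), ¬ Derives Δ' Fm.bot ∧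
      Δ.map (Fm.rename r) ⊆ Δ' ∧ (A.rename r ∈ Δ' ∨ A.neg.rename r ∈ Δ' ∧
        ∀ σ B, A = Fm.all σ B →
          ∃ t : Tm Γ' σ, ((B.rename r.lift).inst t).neg ∈ Δ') := by
  have hid : ∀ B : Fm Γ, B.rename (fun _ v => v) = B := fun B => by
    rw [Fm.rename_eq_subst]; exact Fm.subst_var B
  have hmap : Δ.map (Fm.rename (fun _ v => v)) = Δ := by
    conv_rhs => rw [← List.map_id Δ]
    exact List.map_congr_left fun B _ => hid B
  by_cases hA : Derives (A :: Δ) Fm.bot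
  · have hn : ¬ Derives (A.neg :: Δ) Fm.bot := fun h' =>
      h (Derives.impE (Derives.impI hA) (Derives.contra h'))
    by_cases hq : ∃ σ B, A = Fm.all σ B
    · obtain ⟨σ, B, rfl⟩ := hq
      refine ⟨σ :: Γ, Ren.wk, B.neg :: ((Fm.all σ B).neg :: Δ).map Fm.wk, ?_, ?_, Or.inr ⟨?_, ?_⟩⟩
      -- If the fresh counterexample were inconsistent, generalising over its variable would derive
      -- the universal formula that has just been negated.
      · intro h'
        exact hn (Derives.impE (Derives.hyp (List.mem_cons_self ..))
          (Derives.allI (Derives.contra h')))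
      · intro C hC
        exact List.mem_cons_of_mem _ (List.mem_cons_of_mem _ hC)
      · exact List.mem_cons_of_mem _ (List.mem_cons_self ..)
      · intro σ' B' hB
        cases hB
        refine ⟨Tm.var Var.z, ?_⟩
        rw [Fm.rename_lift_inst_var]
        exact List.mem_cons_self ..
    · refine ⟨Γ, fun _ v => v, A.neg :: Δ, hn, ?_, Or.inr ⟨?_, ?_⟩⟩
      · rw [hmap]; exact List.subset_cons_self _ _
      · rw [hid]; exact List.mem_cons_self ..
      · intro σ B hB
        exact (hq ⟨σ, B, hB⟩).elim
  · refine ⟨Γ, fun _ v => v, A :: Δ, hA, ?_, Or.inl ?_⟩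
    · rw [hmap]; exact List.subset_cons_self _ _
    · rw [hid]; exact List.mem_cons_self ..

/-- The result of deciding a formula at a stage. -/
structure Stage.Step (p : Stage) (n : ℕ) where
  next : Stage
  r : Ren p.Γ next.Γ
  sub : p.Δ.map (Fm.rename r) ⊆ next.Δ
  decide : (p.todo n.unpair.1 n.unpair.2).rename r ∈ next.Δ ∨
    (p.todo n.unpair.1 n.unpair.2).neg.rename r ∈ next.Δ ∧
      ∀ σ B, p.todo n.unpair.1 n.unpair.2 = Fm.all σ B →
        ∃ t : Tm next.Γ σ, ((B.rename r.lift).inst t).neg ∈ next.Δ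
  todo_old : ∀ i ≤ n, ∀ j, next.todo i j = (p.todo i j).rename r
  todo_new : ∀ A : Fm next.Γ, ∃ j, next.todo (n + 1) j = A

/-- Rows up to `n` are carried along by renaming, and row `n + 1` becomes an enumeration of the
formulas of the new context, which is possible as the language is countable. -/
theorem Stage.exists_step (p : Stage) (n : ℕ) : Nonempty (p.Step n) := by
  obtain ⟨Γ', r, Δ', h₁, h₂, h₃⟩ := Stage.exists_decide p.cons (p.todo n.unpair.1 n.unpair.2)
  have : Nonempty (Fm Γ') := ⟨Fm.bot⟩
  obtain ⟨f, hf⟩ := exists_surjective_nat (Fm Γ')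
  refine ⟨⟨⟨Γ', Δ', h₁, fun i j => if i ≤ n then (p.todo i j).rename r else f j⟩,
    r, h₂, h₃, ?_, ?_⟩⟩
  · intro i hi j
    simp [hi]
  · intro A
    obtain ⟨j, hj⟩ := hf A
    exact ⟨j, by simp [hj]⟩

/-- A sequence of consistent stages in which every formula of every stage is decided. -/
structure Chain where
  Γ : ℕ → Ctx
  Δ : ∀ n, List (Fm (Γ n))
  cons : ∀ n, ¬ Derives (Δ n) Fm.bot
  r : ∀ n, Ren (Γ n) (Γ (n + 1))
  sub : ∀ n, (Δ n).map (Fm.rename (r n)) ⊆ Δ (n + 1)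
  /-- Every coherent sequence of formulas is decided, with a witness if it is universal. -/
  decide : ∀ (A : ∀ n, Fm (Γ n)) (n₀ : ℕ), (∀ n ≥ n₀, A (n + 1) = (A n).rename (r n)) →
    ∃ n ≥ n₀, A (n + 1) ∈ Δ (n + 1) ∨ (A (n + 1)).neg ∈ Δ (n + 1) ∧
      ∀ σ B, A n = Fm.all σ B →
        ∃ t : Tm (Γ (n + 1)) σ, ((B.rename (r n).lift).inst t).neg ∈ Δ (n + 1)

theorem exists_chain (Δ₀ : List (Fm [])) (h : ¬ Derives Δ₀ Fm.bot) :
    ∃ c : Chain, ∀ A ∈ Δ₀, A.subst Sub.empty ∈ c.Δ 0 := by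
  have : Nonempty (Fm []) := ⟨Fm.bot⟩
  obtain ⟨f, hf⟩ := exists_surjective_nat (Fm [])
  let step : ∀ (p : Stage) (n : ℕ), p.Step n := fun p n => Classical.choice (p.exists_step n)
  let P : ℕ → Stage := fun n =>
    Nat.rec ⟨[], Δ₀, h, fun _ j => f j⟩ (fun n p => (step p n).next) n
  have hold : ∀ n i, i ≤ n → ∀ j, (P (n + 1)).todo i j = ((P n).todo i j).rename (step (P n) n).r :=
    fun n i hi j => (step (P n) n).todo_old i hi j
  have hnew : ∀ n (A : Fm (P n).Γ), ∃ j, (P n).todo n j = A := by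
    intro n
    cases n with
    | zero => exact hf
    | succ n => exact (step (P n) n).todo_new
  refine ⟨⟨fun n => (P n).Γ, fun n => (P n).Δ, fun n => (P n).cons, fun n => (step (P n) n).r,
    fun n => (step (P n) n).sub, ?_⟩, ?_⟩
  swap
  · intro A hA
    show A.subst (Sub.empty : Sub [] []) ∈ Δ₀
    rw [Fm.subst_nil]
    exact hA
  intro A n₀ hA
  obtain ⟨j, hj⟩ := hnew n₀ (A n₀)
  have hm : ∀ n ≥ n₀, (P n).todo n₀ j = A n := by
    intro n hn
    induction n, hn using Nat.le_induction with
    | base => exact hj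
    | succ n hn ih => rw [hold n n₀ hn j, ih, hA n hn]
  -- Entry `j` of row `n₀` is decided at stage `Nat.pair n₀ j`; this is not before `n₀`, so the row
  -- is already fixed.
  refine ⟨Nat.pair n₀ j, Nat.left_le_pair _ _, ?_⟩
  have hd := (step (P (Nat.pair n₀ j)) (Nat.pair n₀ j)).decide
  rw [Nat.unpair_pair, hm _ (Nat.left_le_pair _ _)] at hd
  have e := hA _ (Nat.left_le_pair n₀ j)
  rw [e]
  exact hd

open Filter

namespace Chain

variable (c : Chain)

theorem derives_succ {n : ℕ} {A : Fm (c.Γ n)} (h : Derives (c.Δ n) A) :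
    Derives (c.Δ (n + 1)) (A.rename (c.r n)) :=
  (h.rename (c.r n)).mono (c.sub n)

theorem derives_of_le {A : ∀ n, Fm (c.Γ n)} {n₀ : ℕ}
    (hA : ∀ n ≥ n₀, A (n + 1) = (A n).rename (c.r n)) (h : Derives (c.Δ n₀) (A n₀)) :
    ∀ n ≥ n₀, Derives (c.Δ n) (A n) := by
  intro n hn
  induction n, hn using Nat.le_induction with
  | base => exact h
  | succ n hn ih =>
    rw [hA n hn]
    exact c.derives_succ ih

/-- A family of formulas that commutes with the renamings from some point on. -/
def Coherent (A : ∀ n, Fm (c.Γ n)) : Prop := ∀ᶠ n in atTop, A (n + 1) = (A n).rename (c.r n)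

theorem Coherent.eventually {c : Chain} {A : ∀ n, Fm (c.Γ n)} (hA : c.Coherent A)
    (h : ∃ᶠ n in atTop, Derives (c.Δ n) (A n)) : ∀ᶠ n in atTop, Derives (c.Δ n) (A n) := by
  obtain ⟨n₀, h₀⟩ := eventually_atTop.1 hA
  obtain ⟨n₁, hn₁, h₁⟩ := frequently_atTop.1 h n₀
  exact eventually_atTop.2 ⟨n₁, c.derives_of_le (fun n hn => h₀ n (hn₁.trans hn)) h₁⟩

theorem Coherent.decide {c : Chain} {A : ∀ n, Fm (c.Γ n)} (hA : c.Coherent A)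
    (h : ¬ ∀ᶠ n in atTop, Derives (c.Δ n) (A n)) :
    ∀ᶠ n in atTop, Derives (c.Δ n) (A n).neg := by
  obtain ⟨n₀, h₀⟩ := eventually_atTop.1 hA
  have hneg : c.Coherent fun n => (A n).neg := by
    filter_upwards [hA] with n hn
    rw [hn]; rfl
  refine hneg.eventually (frequently_atTop.2 fun k => ?_)
  obtain ⟨n, hn, h₁ | h₁⟩ := c.decide A (max n₀ k) fun n hn => h₀ n ((le_max_left _ _).trans hn)
  · refine (h (hA.eventually (frequently_atTop.2 fun k' => ?_))).elim
    refine ⟨max (n + 1) k', le_max_right _ _, ?_⟩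
    exact c.derives_of_le (fun m hm => h₀ m (by have := le_max_left n₀ k; omega))
      (Derives.hyp h₁) _ (le_max_left _ _)
  · exact ⟨n + 1, by have := le_max_right n₀ k; omega, Derives.hyp h₁.1⟩

theorem not_eventually_bot : ¬ ∀ᶠ n in atTop, Derives (c.Δ n) Fm.bot := fun h =>
  let ⟨n, hn⟩ := h.exists
  c.cons n hn

/-- Coherent sequences of terms, which represent the elements of the Henkin model. -/
def Elt (σ : Ty) : Type :=
  {x : ∀ n, Tm (c.Γ n) σ // ∀ᶠ n in atTop, x (n + 1) = (x n).rename (c.r n)}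

def eltSetoid (σ : Ty) : Setoid (c.Elt σ) where
  r x y := ∀ᶠ n in atTop, Derives (c.Δ n) (x.1 n ≐ y.1 n)
  iseqv := ⟨fun _ => Eventually.of_forall fun _ => Derives.eqI _,
    fun h => h.mono fun _ => Derives.eq_symm,
    fun h h' => (h.and h').mono fun _ hn => hn.1.eq_trans hn.2⟩

def eltApp {σ τ : Ty} (x : c.Elt (σ ⇒ τ)) (y : c.Elt σ) : c.Elt τ :=
  ⟨fun n => x.1 n ⬝ y.1 n, by
    filter_upwards [x.2, y.2] with n hx hy
    rw [hx, hy]; rfl⟩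

/-- The Henkin model. -/
def str : Str where
  C σ := Quotient (c.eltSetoid σ)
  app := Quotient.map₂ c.eltApp fun _ _ h _ _ h' => (h.and h').mono fun _ hn =>
    hn.1.eq_app hn.2
  cst k := Quotient.mk _ ⟨fun _ => Tm.cst k, Eventually.of_forall fun _ => rfl⟩
  st := Quotient.lift (fun x => ∀ᶠ n in atTop, Derives (c.Δ n) (Fm.st (x.1 n))) fun _ _ h =>
    propext ⟨fun h' => (h.and h').mono fun _ hn => hn.1.st_congr hn.2,
      fun h' => (h.and h').mono fun _ hn => hn.1.eq_symm.st_congr hn.2⟩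

abbrev EltEnv (Γ : Ctx) : Type := ∀ σ, Var Γ σ → c.Elt σ

def EltEnv.sub {c : Chain} {Γ : Ctx} (θ : c.EltEnv Γ) (n : ℕ) : Sub Γ (c.Γ n) :=
  fun _ v => (θ _ v).1 n

def EltEnv.env {c : Chain} {Γ : Ctx} (θ : c.EltEnv Γ) : Env c.str Γ :=
  fun _ v => Quotient.mk _ (θ _ v)

def EltEnv.cons {c : Chain} {Γ : Ctx} {ρ : Ty} (x : c.Elt ρ) (θ : c.EltEnv Γ) : c.EltEnv (ρ :: Γ)
  | _, Var.z => x
  | _, Var.s v => θ _ v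

/-- A context has finitely many variables, so finitely many thresholds have a common bound. -/
theorem eventually_forall_var {Γ : Ctx} {P : ∀ σ, Var Γ σ → ℕ → Prop}
    (h : ∀ σ v, ∀ᶠ n in atTop, P σ v n) : ∀ᶠ n in atTop, ∀ σ v, P σ v n := by
  induction Γ with
  | nil => exact Eventually.of_forall fun n σ v => by cases v
  | cons ρ Γ ih =>
    filter_upwards [h _ Var.z, ih fun σ v => h σ (Var.s v)] with n h₁ h₂ σ v
    cases v with
    | z => exact h₁
    | s v => exact h₂ _ v

theorem EltEnv.sub_succ {c : Chain} {Γ : Ctx} (θ : c.EltEnv Γ) :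
    ∀ᶠ n in atTop, θ.sub (n + 1) = (θ.sub n).comp (c.r n).toSub := by
  filter_upwards [eventually_forall_var fun σ v => (θ σ v).2] with n hn
  funext σ v
  show (θ _ v).1 (n + 1) = ((θ _ v).1 n).subst _
  rw [hn, Tm.rename_eq_subst]

theorem EltEnv.coherent {c : Chain} {Γ : Ctx} (θ : c.EltEnv Γ) (A : Fm Γ) :
    c.Coherent fun n => A.subst (θ.sub n) := by
  filter_upwards [θ.sub_succ] with n hn
  rw [hn, Fm.rename_eq_subst, Fm.subst_subst]

def EltEnv.term {c : Chain} {Γ : Ctx} (θ : c.EltEnv Γ) {σ : Ty} (t : Tm Γ σ) : c.Elt σ :=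
  ⟨fun n => t.subst (θ.sub n), by
    filter_upwards [θ.sub_succ] with n hn
    rw [hn, Tm.rename_eq_subst, Tm.subst_subst]⟩

theorem EltEnv.val {c : Chain} {Γ : Ctx} (θ : c.EltEnv Γ) {σ : Ty} (t : Tm Γ σ) :
    t.val θ.env = Quotient.mk _ (θ.term t) := by
  induction t with
  | var v => rfl
  | cst k => rfl
  | app t u iht ihu => rw [Tm.val, iht, ihu]; rfl

theorem EltEnv.env_cons {c : Chain} {Γ : Ctx} {ρ : Ty} (x : c.Elt ρ) (θ : c.EltEnv Γ) :
    (EltEnv.cons x θ).env = Env.cons (M := c.str) (Quotient.mk _ x) θ.env := by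
  funext σ v
  cases v <;> rfl

theorem EltEnv.sub_cons {c : Chain} {Γ : Ctx} {ρ : Ty} (x : c.Elt ρ) (θ : c.EltEnv Γ) (n : ℕ) :
    (EltEnv.cons x θ).sub n = Sub.cons (x.1 n) (θ.sub n) :=
  Sub.ext_cons rfl fun _ _ => rfl

/-- Values before `m` are arbitrary. Induction on `m` with the family shifted by one avoids
transport between the types `X n`. -/
theorem exists_seq_of_mem {X : ℕ → Type} [∀ n, Nonempty (X n)] (f : ∀ n, X n → X (n + 1)) (m : ℕ)
    (a : X m) : ∃ x : ∀ n, X n, x m = a ∧ ∀ n ≥ m, x (n + 1) = f n (x n) := by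
  induction m generalizing X with
  | zero => exact ⟨fun n => Nat.rec a (fun n y => f n y) n, rfl, fun _ _ => rfl⟩
  | succ m ih =>
    obtain ⟨x, hx, hx'⟩ := ih (X := fun n => X (n + 1)) (fun n => f (n + 1)) a
    refine ⟨fun n => Nat.casesOn n (Classical.arbitrary _) x, hx, fun n hn => ?_⟩
    obtain ⟨k, rfl⟩ : ∃ k, n = k + 1 := ⟨n - 1, by omega⟩
    exact hx' k (by omega)

theorem exists_elt {σ : Ty} (m : ℕ) (t : Tm (c.Γ m) σ) : ∃ x : c.Elt σ, x.1 m = t ∧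
    ∀ n ≥ m, x.1 (n + 1) = (x.1 n).rename (c.r n) := by
  have : ∀ n, Nonempty (Tm (c.Γ n) σ) := fun n => ⟨(zeroOf σ).ofClosed⟩
  obtain ⟨x, hx, hx'⟩ := exists_seq_of_mem (fun n (t : Tm (c.Γ n) σ) => t.rename (c.r n)) m t
  exact ⟨⟨x, eventually_atTop.2 ⟨m, hx'⟩⟩, hx, hx'⟩

/-- The Henkin property: the universal formula is decided at some stage, necessarily negatively, and
the witness chosen there, renamed through all later stages, is an element of the model. -/
theorem exists_counterexample {Γ : Ctx} {σ : Ty} (θ : c.EltEnv Γ) (B : Fm (σ :: Γ))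
    (h : ¬ ∀ᶠ n in atTop, Derives (c.Δ n) ((Fm.all σ B).subst (θ.sub n))) :
    ∃ x : c.Elt σ, ¬ ∀ᶠ n in atTop, Derives (c.Δ n) (B.subst ((EltEnv.cons x θ).sub n)) := by
  obtain ⟨n₀, h₀⟩ := eventually_atTop.1 ((θ.coherent (Fm.all σ B)).and θ.sub_succ)
  obtain ⟨n₂, h₂⟩ := eventually_atTop.1 ((θ.coherent (Fm.all σ B)).decide h)
  obtain ⟨n, hn, h₁⟩ := c.decide (fun n => (Fm.all σ B).subst (θ.sub n)) (max n₀ n₂)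
    fun n hn => (h₀ n ((le_max_left _ _).trans hn)).1
  have hn₀ : n₀ ≤ n := (le_max_left _ _).trans hn
  have hn₂ : n₂ ≤ n + 1 := ((le_max_right _ _).trans hn).trans (Nat.le_succ _)
  obtain h₁ | ⟨-, h₁⟩ := h₁
  · exact (c.cons (n + 1) (Derives.impE (h₂ _ hn₂) (Derives.hyp h₁))).elim
  obtain ⟨t, ht⟩ := h₁ σ (B.subst (θ.sub n).lift) rfl
  obtain ⟨x, hx, hx'⟩ := c.exists_elt (n + 1) t
  refine ⟨x, fun hB => ?_⟩
  have e : ((B.subst (θ.sub n).lift).rename (c.r n).lift).inst t =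
      B.subst ((EltEnv.cons x θ).sub (n + 1)) := by
    rw [Fm.rename_eq_subst, Fm.subst_subst, Ren.toSub_lift, Sub.comp_lift, ← (h₀ n hn₀).2,
      Fm.lift_inst, EltEnv.sub_cons, hx]
  rw [e] at ht
  have hneg := c.derives_of_le (A := fun k => (B.subst ((EltEnv.cons x θ).sub k)).neg) (n₀ := n + 1)
    (fun k hk => by
      rw [EltEnv.sub_cons, EltEnv.sub_cons, hx' k hk, (h₀ k (by omega)).2]
      show _ = Fm.imp (Fm.rename _ _) _
      rw [Fm.rename_eq_subst, Fm.subst_subst]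
      congr 2
      exact Sub.ext_cons (Tm.rename_eq_subst _ _) fun _ _ => rfl) (Derives.hyp ht)
  exact c.not_eventually_bot ((hB.and (eventually_atTop.2 ⟨_, hneg⟩)).mono fun k hk =>
    Derives.impE hk.2 hk.1)

/-- The truth lemma, by induction on the formula. Implication needs that every formula is eventually
decided, and the universal quantifier needs `exists_counterexample`. -/
theorem sat_iff {Γ : Ctx} (A : Fm Γ) (θ : c.EltEnv Γ) :
    A.Sat θ.env ↔ ∀ᶠ n in atTop, Derives (c.Δ n) (A.subst (θ.sub n)) := by
  induction A with
  | eq t u =>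
    simp only [Fm.Sat, EltEnv.val]
    exact Quotient.eq (r := c.eltSetoid _)
  | st t =>
    simp only [Fm.Sat, EltEnv.val]
    rfl
  | bot => exact ⟨False.elim, c.not_eventually_bot⟩
  | imp A B ihA ihB =>
    simp only [Fm.Sat, ihA, ihB]
    constructor
    · intro h
      by_cases hA : ∀ᶠ n in atTop, Derives (c.Δ n) (A.subst (θ.sub n))
      · exact (h hA).mono fun n hn => Derives.impI (hn.mono (List.subset_cons_self _ _))
      · refine ((θ.coherent A).decide hA).mono fun n hn => Derives.impI (Derives.botE ?_)
        exact Derives.impE (hn.mono (List.subset_cons_self _ _))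
          (Derives.hyp (List.mem_cons_self ..))
    · intro h hA
      exact (h.and hA).mono fun n hn => Derives.impE hn.1 hn.2
  | all σ B ih =>
    constructor
    · intro h
      by_contra hcon
      obtain ⟨x, hx⟩ := c.exists_counterexample θ B hcon
      refine hx ((ih _).1 ?_)
      rw [EltEnv.env_cons]
      exact h _
    · intro h a
      obtain ⟨x, rfl⟩ := Quotient.exists_rep a
      have := (ih (EltEnv.cons x θ)).2 (h.mono fun n hn => by
        rw [EltEnv.sub_cons, ← Fm.lift_inst]
        exact Derives.allE hn _)
      rwa [EltEnv.env_cons] at this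

theorem str_isModel : c.str.IsModel := by
  refine ⟨fun {Γ A} hA e => ?_⟩
  have he : e = EltEnv.env (c := c) (fun σ v => Quotient.out (e σ v)) := by
    funext σ v
    exact (Quotient.out_eq _).symm
  rw [he, sat_iff]
  exact Eventually.of_forall fun n => Derives.ax (hA.subst _)

end Chain

/-- Completeness: a closed formula that holds in all models of `P` and of the closed hypotheses is
derivable. -/
theorem derives_of_forall_model {Δ : List (Fm [])} {A : Fm []}
    (h : ∀ M : Str, M.IsModel → (∀ B ∈ Δ, B.Sat (Env.nil (M := M))) → A.Sat (Env.nil (M := M))) :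
    Derives Δ A := by
  by_contra hA
  obtain ⟨c, hc⟩ := exists_chain (A.neg :: Δ) fun h' => hA (Derives.contra h')
  let θ : c.EltEnv [] := fun _ v => by cases v
  have hθ : θ.env = Env.nil (M := c.str) := by
    funext σ v; cases v
  have hsat : ∀ B ∈ A.neg :: Δ, B.Sat (Env.nil (M := c.str)) := by
    intro B hB
    rw [← hθ, c.sat_iff]
    have hs : ∀ n, θ.sub n = Sub.empty := fun n => by funext σ v; cases v
    refine eventually_atTop.2 ⟨0, c.derives_of_le (fun n _ => ?_) (Derives.hyp ?_)⟩
    · rw [hs, hs, Fm.rename_eq_subst, Fm.subst_subst]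
      congr 1
      funext σ v; cases v
    · rw [hs]; exact hc B hB
  exact hsat A.neg (List.mem_cons_self ..) (h c.str c.str_isModel fun B hB =>
    hsat B (List.mem_cons_of_mem _ hB))

/-! ### Evaluation in structures -/

infixl:80 " ⬩ " => Str.app _

section Basic

variable {M : Str} {Γ Δ : Ctx} {ρ σ τ : Ty}

@[simp] theorem val_app (e : Env M Γ) (t : Tm Γ (σ ⇒ τ)) (u : Tm Γ σ) :
    (t ⬝ u).val e = t.val e ⬩ u.val e := rfl
@[simp] theorem val_cst (e : Env M Γ) (k : Cst σ) : (Tm.cst k : Tm Γ σ).val e = M.cst k := rfl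

section Variables

variable {a b c d f g : Ty} (e : Env M Γ) (x : M.C a) (y : M.C b) (z : M.C c) (u : M.C d)
  (v : M.C f) (w : M.C g)

@[simp] theorem val_v0 : (v0 : Tm (a :: Γ) a).val (Env.cons x e) = x := rfl
@[simp] theorem val_v1 : (v1 : Tm (a :: b :: Γ) b).val (Env.cons x (Env.cons y e)) = y := rfl
@[simp] theorem val_v2 :
    (v2 : Tm (a :: b :: c :: Γ) c).val (Env.cons x (Env.cons y (Env.cons z e))) = z := rfl
@[simp] theorem val_v3 : (v3 : Tm (a :: b :: c :: d :: Γ) d).val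
    (Env.cons x (Env.cons y (Env.cons z (Env.cons u e)))) = u := rfl
@[simp] theorem val_v4 : (v4 : Tm (a :: b :: c :: d :: f :: Γ) f).val
    (Env.cons x (Env.cons y (Env.cons z (Env.cons u (Env.cons v e))))) = v := rfl
@[simp] theorem val_v5 : (v5 : Tm (a :: b :: c :: d :: f :: g :: Γ) g).val
    (Env.cons x (Env.cons y (Env.cons z (Env.cons u (Env.cons v (Env.cons w e)))))) = w := rfl

end Variables

/-- The environment of the values of a substitution. -/
def Sub.env (θ : Sub Γ Δ) (e : Env M Δ) : Env M Γ := fun _ v => (θ _ v).val e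

theorem val_subst (θ : Sub Γ Δ) (e : Env M Δ) (t : Tm Γ σ) :
    (t.subst θ).val e = t.val (θ.env e) := by
  induction t with
  | var v => rfl
  | cst k => rfl
  | app t u iht ihu => simp only [Tm.subst, val_app, iht, ihu]

theorem val_rename (r : Ren Γ Δ) (e : Env M Δ) (t : Tm Γ σ) :
    (t.rename r).val e = t.val (fun _ v => e _ (r _ v)) := by
  rw [Tm.rename_eq_subst, val_subst]; rfl

@[simp] theorem val_wk (a : M.C ρ) (e : Env M Γ) (t : Tm Γ σ) :
    t.wk.val (Env.cons a e) = t.val e := val_rename _ _ t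

theorem Env.eq_nil (e : Env M []) : e = Env.nil := by
  funext σ v; cases v

@[simp] theorem val_ofClosed (e : Env M Γ) (t : Tm [] σ) :
    (t.ofClosed : Tm Γ σ).val e = t.val Env.nil := by
  rw [Tm.ofClosed, val_rename]
  congr 1
  exact Env.eq_nil _

theorem Env.ext_cons {e e' : Env M (ρ :: Γ)} (h0 : e _ Var.z = e' _ Var.z)
    (hs : ∀ σ (v : Var Γ σ), e _ (Var.s v) = e' _ (Var.s v)) : e = e' := by
  funext σ v
  cases v with
  | z => exact h0
  | s v => exact hs _ v

@[simp] theorem Sub.env_cons (t : Tm Δ ρ) (θ : Sub Γ Δ) (e : Env M Δ) :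
    (Sub.cons t θ).env e = Env.cons (t.val e) (θ.env e) :=
  Env.ext_cons rfl fun _ _ => rfl

theorem Sub.env_lift (θ : Sub Γ Δ) (e : Env M Δ) (a : M.C ρ) :
    θ.lift.env (Env.cons a e) = Env.cons a (θ.env e) :=
  Env.ext_cons rfl fun _ v => val_wk a e (θ _ v)

theorem sat_subst (θ : Sub Γ Δ) (e : Env M Δ) (A : Fm Γ) :
    (A.subst θ).Sat e ↔ A.Sat (θ.env e) := by
  induction A generalizing Δ with
  | eq t u => simp only [Fm.subst, Fm.Sat, val_subst]
  | st t => simp only [Fm.subst, Fm.Sat, val_subst]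
  | bot => rfl
  | imp A B ihA ihB => simp only [Fm.subst, Fm.Sat, ihA, ihB]
  | all σ A ih => simp only [Fm.subst, Fm.Sat, ih, Sub.env_lift]

@[simp] theorem sat_inst (A : Fm (ρ :: Γ)) (t : Tm Γ ρ) (e : Env M Γ) :
    (A.inst t).Sat e ↔ A.Sat (Env.cons (t.val e) e) := by
  rw [Fm.inst, sat_subst, Sub.env_cons]; rfl

theorem sat_rename_wk_lift_lift (A : Fm (τ :: σ :: Γ)) (e : Env M Γ) (a : M.C τ) (b : M.C σ)
    (c : M.C ρ) :
    (A.rename (Ren.wk (ρ := ρ)).lift.lift).Sat (Env.cons a (Env.cons b (Env.cons c e))) ↔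
      A.Sat (Env.cons a (Env.cons b e)) := by
  rw [Fm.rename_eq_subst, sat_subst, Ren.toSub_lift, Ren.toSub_lift, Sub.env_lift, Sub.env_lift]
  rfl

variable (e : Env M Γ) (A B : Fm Γ)

@[simp] theorem sat_eq (t u : Tm Γ σ) : (t ≐ u).Sat e ↔ t.val e = u.val e := Iff.rfl
@[simp] theorem sat_st (t : Tm Γ σ) : (Fm.st t).Sat e ↔ M.st (t.val e) := Iff.rfl
@[simp] theorem sat_bot : (Fm.bot : Fm Γ).Sat e ↔ False := Iff.rfl
@[simp] theorem sat_imp : (A ⇾ B).Sat e ↔ (A.Sat e → B.Sat e) := Iff.rfl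
@[simp] theorem sat_all (A : Fm (σ :: Γ)) :
    (Fm.all σ A).Sat e ↔ ∀ a, A.Sat (Env.cons a e) := Iff.rfl
@[simp] theorem sat_neg : A.neg.Sat e ↔ ¬ A.Sat e := Iff.rfl
@[simp] theorem sat_and : (A.and B).Sat e ↔ A.Sat e ∧ B.Sat e := by
  simp [Fm.and]
@[simp] theorem sat_or : (A.or B).Sat e ↔ A.Sat e ∨ B.Sat e := by
  simp [Fm.or, or_iff_not_imp_left]
@[simp] theorem sat_ex (A : Fm (σ :: Γ)) : (Fm.ex σ A).Sat e ↔ ∃ a, A.Sat (Env.cons a e) := by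
  simp [Fm.ex]
@[simp] theorem sat_allSt (A : Fm (σ :: Γ)) :
    (Fm.allSt σ A).Sat e ↔ ∀ a, M.st a → A.Sat (Env.cons a e) := Iff.rfl
@[simp] theorem sat_exSt (A : Fm (σ :: Γ)) :
    (Fm.exSt σ A).Sat e ↔ ∃ a, M.st a ∧ A.Sat (Env.cons a e) := by
  simp [Fm.exSt]
@[simp] theorem sat_allInf (A : Fm (Ty.nat :: Γ)) :
    (Fm.allInf A).Sat e ↔ ∀ a : M.C Ty.nat, ¬ M.st a → A.Sat (Env.cons a e) := Iff.rfl

@[simp] theorem internal_eq (t u : Tm Γ σ) : (t ≐ u).Internal := trivial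
@[simp] theorem internal_le (t u : Tm Γ Ty.nat) : (le t u).Internal := trivial
@[simp] theorem internal_lt (t u : Tm Γ Ty.nat) : (lt t u).Internal := trivial
@[simp] theorem internal_imp : (A ⇾ B).Internal ↔ A.Internal ∧ B.Internal := Iff.rfl
@[simp] theorem internal_neg : A.neg.Internal ↔ A.Internal := by simp [Fm.neg, Fm.Internal]
@[simp] theorem internal_and : (A.and B).Internal ↔ A.Internal ∧ B.Internal := by
  simp [Fm.and]
@[simp] theorem internal_or : (A.or B).Internal ↔ A.Internal ∧ B.Internal := by
  simp [Fm.or]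
@[simp] theorem internal_all (A : Fm (σ :: Γ)) : (Fm.all σ A).Internal ↔ A.Internal := Iff.rfl
@[simp] theorem internal_ex (A : Fm (σ :: Γ)) : (Fm.ex σ A).Internal ↔ A.Internal := by
  simp [Fm.ex]
@[simp] theorem internal_agree (f g : Tm Γ ty1) (N : Tm Γ Ty.nat) : (agree f g N).Internal := by
  simp [agree]
@[simp] theorem internal_cont (Y : Tm Γ ty2) : (cont Y).Internal := by
  simp [cont]

end Basic

/-! ### Combinators, recursors and induction in models of `P` -/

section Model

variable {M : Str} {Γ : Ctx} {ρ σ τ : Ty}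

instance : Zero (M.C Ty.nat) := ⟨M.cst Cst.zero⟩

/-- The successor of a number of the structure. -/
def ns (n : M.C Ty.nat) : M.C Ty.nat := M.cst Cst.succ ⬩ n

def snil : M.C (Ty.seq σ) := M.cst (Cst.nil σ)

def scons (a : M.C σ) (s : M.C (Ty.seq σ)) : M.C (Ty.seq σ) := M.cst (Cst.cons σ) ⬩ a ⬩ s

@[simp] theorem val_zero (e : Env M Γ) : zero.val e = 0 := rfl
@[simp] theorem val_suc (e : Env M Γ) (t : Tm Γ Ty.nat) : (suc t).val e = ns (t.val e) := rfl
@[simp] theorem val_nil (e : Env M Γ) : (nil : Tm Γ (Ty.seq σ)).val e = snil := rfl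
@[simp] theorem val_cons (e : Env M Γ) (t : Tm Γ σ) (u : Tm Γ (Ty.seq σ)) :
    (cons t u).val e = scons (t.val e) (u.val e) := rfl

variable [hM : M.IsModel]

@[simp] theorem proj_app (x : M.C σ) (y : M.C τ) : M.cst (Cst.proj σ τ) ⬩ x ⬩ y = x :=
  hM.sat (Axm.proj v0 v1) (Env.cons x (Env.cons y Env.nil))

@[simp] theorem comb_app (x : M.C (ρ ⇒ σ ⇒ τ)) (y : M.C (ρ ⇒ σ)) (z : M.C ρ) :
    M.cst (Cst.comb ρ σ τ) ⬩ x ⬩ y ⬩ z = x ⬩ z ⬩ (y ⬩ z) :=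
  hM.sat (Axm.comb v0 v1 v2) (Env.cons x (Env.cons y (Env.cons z Env.nil)))

@[simp] theorem lam_app (e : Env M Γ) (t : Tm (σ :: Γ) τ) (a : M.C σ) :
    t.lam.val e ⬩ a = t.val (Env.cons a e) := by
  -- Induction on a term requires its context to be a variable, so `σ :: Γ` is replaced by `Δ`
  -- together with an equation.
  have : ∀ {Δ : Ctx} {τ : Ty} (t : Tm Δ τ) (h : Δ = σ :: Γ),
      (h ▸ t : Tm (σ :: Γ) τ).lam.val e ⬩ a = (h ▸ t : Tm (σ :: Γ) τ).val (Env.cons a e) := by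
    intro Δ τ t h
    subst h
    induction t with
    | var v =>
      cases v with
      | z => simp [Tm.lam]; rfl
      | s v => simp [Tm.lam]; rfl
    | cst k => simp [Tm.lam]
    | app t u iht ihu =>
      simp only [Tm.lam, val_app, val_cst, comb_app]
      rw [iht, ihu]
  exact this t rfl

theorem funext_app {f g : M.C (σ ⇒ τ)} (h : ∀ x, f ⬩ x = g ⬩ x) : f = g :=
  hM.sat (Axm.ext v0 v1) (Env.cons f (Env.cons g Env.nil)) h

@[simp] theorem recN_zero (y : M.C ρ) (z : M.C (ρ ⇒ Ty.nat ⇒ ρ)) :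
    M.cst (Cst.recN ρ) ⬩ 0 ⬩ y ⬩ z = y :=
  hM.sat (Axm.natRec_zero v0 v1) (Env.cons y (Env.cons z Env.nil))

@[simp] theorem recN_suc (n : M.C Ty.nat) (y : M.C ρ) (z : M.C (ρ ⇒ Ty.nat ⇒ ρ)) :
    M.cst (Cst.recN ρ) ⬩ ns n ⬩ y ⬩ z = z ⬩ (M.cst (Cst.recN ρ) ⬩ n ⬩ y ⬩ z) ⬩ n :=
  hM.sat (Axm.natRec_suc v0 v1 v2) (Env.cons n (Env.cons y (Env.cons z Env.nil)))

@[simp] theorem recL_nil (y : M.C ρ) (z : M.C (ρ ⇒ σ ⇒ ρ)) :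
    M.cst (Cst.recL σ ρ) ⬩ snil ⬩ y ⬩ z = y :=
  hM.sat (Axm.seqRec_nil v0 v1) (Env.cons y (Env.cons z Env.nil))

@[simp] theorem recL_cons (a : M.C σ) (s : M.C (Ty.seq σ)) (y : M.C ρ) (z : M.C (ρ ⇒ σ ⇒ ρ)) :
    M.cst (Cst.recL σ ρ) ⬩ scons a s ⬩ y ⬩ z = z ⬩ (M.cst (Cst.recL σ ρ) ⬩ s ⬩ y ⬩ z) ⬩ a :=
  hM.sat (Axm.seqRec_cons v0 v1 v2 v3) (Env.cons a (Env.cons s (Env.cons y (Env.cons z Env.nil))))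

omit hM in
@[simp] theorem val_natRec (e : Env M Γ) (n : Tm Γ Ty.nat) (y : Tm Γ ρ)
    (z : Tm Γ (ρ ⇒ Ty.nat ⇒ ρ)) :
    (natRec n y z).val e = M.cst (Cst.recN ρ) ⬩ n.val e ⬩ y.val e ⬩ z.val e := rfl

omit hM in
@[simp] theorem val_seqRec (e : Env M Γ) (s : Tm Γ (Ty.seq σ)) (y : Tm Γ ρ)
    (z : Tm Γ (ρ ⇒ σ ⇒ ρ)) :
    (seqRec s y z).val e = M.cst (Cst.recL σ ρ) ⬩ s.val e ⬩ y.val e ⬩ z.val e := rfl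

theorem seq_cases (s : M.C (Ty.seq σ)) : s = snil ∨ ∃ a t, s = scons a t := by
  have := hM.sat (Axm.seq_cases v0) (Env.cons s Env.nil)
  simpa using this

@[simp] theorem ns_ne_zero (n : M.C Ty.nat) : ns n ≠ 0 :=
  hM.sat (Axm.suc_ne_zero v0) (Env.cons n Env.nil)

@[simp] theorem ns_inj {m n : M.C Ty.nat} : ns m = ns n ↔ m = n :=
  ⟨hM.sat (Axm.suc_inj v0 v1) (Env.cons m (Env.cons n Env.nil)), congrArg ns⟩

/-- The numbers of the model may be nonstandard, so this is the only internal induction available.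
Each use displays the property as a formula, with its parameters in the environment. -/
theorem nat_ind (A : Fm (Ty.nat :: Γ)) (e : Env M Γ) (hA : A.Internal) (h0 : A.Sat (Env.cons 0 e))
    (hs : ∀ n, A.Sat (Env.cons n e) → A.Sat (Env.cons (ns n) e)) (n : M.C Ty.nat) :
    A.Sat (Env.cons n e) := by
  have := hM.sat (Axm.ind A hA) e
  simp only [sat_imp, sat_and, sat_inst, sat_all, sat_subst, Sub.env_cons, val_zero, val_suc,
    val_v0] at this
  exact this ⟨h0, hs⟩ n

theorem nat_ind_st (A : Fm (Ty.nat :: Γ)) (e : Env M Γ) (h0 : A.Sat (Env.cons 0 e))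
    (hs : ∀ n, M.st n → A.Sat (Env.cons n e) → A.Sat (Env.cons (ns n) e)) (n : M.C Ty.nat)
    (hn : M.st n) : A.Sat (Env.cons n e) := by
  have := hM.sat (Axm.ind_st A) e
  simp only [sat_imp, sat_and, sat_inst, sat_allSt, sat_subst, Sub.env_cons, val_zero, val_suc,
    val_v0] at this
  exact this ⟨h0, hs⟩ n hn

theorem nat_cases (n : M.C Ty.nat) : n = 0 ∨ ∃ m, n = ns m := by
  have := nat_ind ((v0 ≐ zero).or (Fm.ex Ty.nat (v1 ≐ suc v0))) (Env.nil (M := M)) (by simp)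
    (by simp) (by simp) n
  simpa using this

/-! ### Arithmetic -/

def npred (n : M.C Ty.nat) : M.C Ty.nat := predC.val Env.nil ⬩ n

def nsub (m n : M.C Ty.nat) : M.C Ty.nat := subC.val Env.nil ⬩ m ⬩ n

@[simp] theorem npred_zero : npred (0 : M.C Ty.nat) = 0 := by simp [npred, predC]
@[simp] theorem npred_ns (n : M.C Ty.nat) : npred (ns n) = n := by simp [npred, predC]
@[simp] theorem nsub_zero (n : M.C Ty.nat) : nsub n 0 = n := by simp [nsub, subC]
@[simp] theorem nsub_ns (m n : M.C Ty.nat) : nsub m (ns n) = npred (nsub m n) := by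
  simp only [nsub, npred, subC, lam_app, val_natRec, val_v0, val_v1, recN_suc, val_app,
    val_ofClosed]
  -- Abstraction through combinators records the whole environment, so the two step functions are
  -- different terms; extensionality identifies their values.
  exact congrArg _ (congrArg _ (funext_app fun _ => funext_app fun _ => by simp))

omit hM in
@[simp] theorem val_sub (e : Env M Γ) (m n : Tm Γ Ty.nat) :
    (sub m n).val e = nsub (m.val e) (n.val e) := by
  simp [sub, nsub]

theorem zero_nsub (n : M.C Ty.nat) : nsub 0 n = 0 := by
  simpa using nat_ind (sub zero v0 ≐ zero) (Env.nil (M := M)) (by simp) (by simp)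
    (by simp +contextual) n

theorem ns_nsub_ns (m n : M.C Ty.nat) : nsub (ns m) (ns n) = nsub m n := by
  simpa using nat_ind (sub (suc v1) (suc v0) ≐ sub v1 v0) (Env.cons m Env.nil) (by simp) (by simp)
    (by simp +contextual) n

theorem nsub_self (n : M.C Ty.nat) : nsub n n = 0 := by
  have := nat_ind (sub v0 v0 ≐ zero) (Env.nil (M := M)) (by simp) (by simp)
    (fun n h => by simpa only [sat_eq, val_sub, val_v0, val_zero, ns_nsub_ns] using h) n
  simpa using this

instance : LE (M.C Ty.nat) := ⟨fun m n => nsub m n = 0⟩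

omit hM in
theorem nat_le_def (m n : M.C Ty.nat) : m ≤ n ↔ nsub m n = 0 := Iff.rfl

omit hM in
@[simp] theorem sat_le (e : Env M Γ) (m n : Tm Γ Ty.nat) :
    (le m n).Sat e ↔ m.val e ≤ n.val e := by
  simp [le, nat_le_def]

theorem ns_le_ns {m n : M.C Ty.nat} : ns m ≤ ns n ↔ m ≤ n := by
  rw [nat_le_def, ns_nsub_ns, nat_le_def]

theorem nat_zero_le (n : M.C Ty.nat) : 0 ≤ n := zero_nsub n

theorem nat_le_zero {n : M.C Ty.nat} : n ≤ 0 ↔ n = 0 := by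
  rw [nat_le_def, nsub_zero]

theorem nat_le_trans (a : M.C Ty.nat) : ∀ b c : M.C Ty.nat, a ≤ b → b ≤ c → a ≤ c := by
  have := nat_ind (Fm.all Ty.nat (Fm.all Ty.nat (le v2 v1 ⇾ le v1 v0 ⇾ le v2 v0)))
    (Env.nil (M := M)) (by simp) (by simp [nat_zero_le]) (fun a ih b c => by
      simp only [sat_all, sat_imp, sat_le, val_v0, val_v1, val_v2] at ih ⊢
      obtain rfl | ⟨b, rfl⟩ := nat_cases b
      · simp [nat_le_zero]
      obtain rfl | ⟨c, rfl⟩ := nat_cases c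
      · simp [nat_le_zero]
      simpa only [ns_le_ns] using ih b c) a
  simpa using this

theorem nat_le_antisymm (a : M.C Ty.nat) : ∀ b : M.C Ty.nat, a ≤ b → b ≤ a → a = b := by
  have := nat_ind (Fm.all Ty.nat (le v1 v0 ⇾ le v0 v1 ⇾ v1 ≐ v0))
    (Env.nil (M := M)) (by simp) (by simp +contextual [nat_le_zero]) (fun a ih b => by
      simp only [sat_all, sat_imp, sat_le, sat_eq, val_v0, val_v1] at ih ⊢
      obtain rfl | ⟨b, rfl⟩ := nat_cases b
      · simp [nat_le_zero]
      simpa only [ns_le_ns, ns_inj] using ih b) a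
  simpa using this

theorem nat_le_total (a : M.C Ty.nat) : ∀ b : M.C Ty.nat, a ≤ b ∨ b ≤ a := by
  have := nat_ind (Fm.all Ty.nat ((le v1 v0).or (le v0 v1)))
    (Env.nil (M := M)) (by simp) (by simp [nat_zero_le]) (fun a ih b => by
      simp only [sat_all, sat_or, sat_le, val_v0, val_v1] at ih ⊢
      obtain rfl | ⟨b, rfl⟩ := nat_cases b
      · simp [nat_zero_le]
      simpa only [ns_le_ns] using ih b) a
  simpa using this

noncomputable instance : LinearOrder (M.C Ty.nat) where
  le_refl := nsub_self
  le_trans := nat_le_trans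
  le_antisymm := nat_le_antisymm
  le_total := nat_le_total
  toDecidableLE := Classical.decRel _

theorem ns_le_iff (a : M.C Ty.nat) : ∀ b : M.C Ty.nat, ns a ≤ b ↔ a < b := by
  have := nat_ind (Fm.all Ty.nat ((le (suc v1) v0 ⇾ (le v0 v1).neg).and
      ((le v0 v1).neg ⇾ le (suc v1) v0)))
    (Env.nil (M := M)) (by simp) (fun b => by
      obtain rfl | ⟨b, rfl⟩ := nat_cases b <;>
      simp [nat_le_zero, nat_zero_le, ns_le_ns, -not_le]) (fun a ih b => by
      simp only [sat_all, sat_and, sat_imp, sat_neg, sat_le, val_suc, val_v0, val_v1] at ih ⊢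
      obtain rfl | ⟨b, rfl⟩ := nat_cases b
      · simp [nat_le_zero, nat_zero_le, -not_le]
      simpa only [ns_le_ns] using ih b) a
  simp only [sat_all, sat_and, sat_imp, sat_neg, sat_le, val_suc, val_v0, val_v1] at this
  exact fun b => (iff_def.2 (this b)).trans not_le

theorem nat_lt_ns {a b : M.C Ty.nat} : a < ns b ↔ a ≤ b := by
  rw [← ns_le_iff, ns_le_ns]

@[simp] theorem sat_lt (e : Env M Γ) (m n : Tm Γ Ty.nat) :
    (lt m n).Sat e ↔ m.val e < n.val e := by
  simp [lt, ns_le_iff]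

theorem nat_le_ns (a : M.C Ty.nat) : a ≤ ns a := (nat_lt_ns.2 le_rfl).le

/-- `x` if `m ≤ n`, and `y` otherwise, in a structure. -/
def sifLe (m n : M.C Ty.nat) (x y : M.C ρ) : M.C ρ := (iteC ρ).val Env.nil ⬩ nsub m n ⬩ x ⬩ y

omit hM in
@[simp] theorem val_ifLe (e : Env M Γ) (m n : Tm Γ Ty.nat) (x y : Tm Γ ρ) :
    (ifLe m n x y).val e = sifLe (m.val e) (n.val e) (x.val e) (y.val e) := by
  simp [ifLe, sifLe]

theorem sifLe_of_le {m n : M.C Ty.nat} (h : m ≤ n) (x y : M.C ρ) : sifLe m n x y = x := by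
  rw [sifLe, (nat_le_def m n).1 h]
  simp [iteC]

theorem sifLe_of_lt {m n : M.C Ty.nat} (h : n < m) (x y : M.C ρ) : sifLe m n x y = y := by
  obtain h0 | ⟨k, hk⟩ := nat_cases (nsub m n)
  · exact (not_le.2 h h0).elim
  · rw [sifLe, hk]
    simp [iteC]

theorem sifLe_eq (m n : M.C Ty.nat) (x y : M.C ρ) : sifLe m n x y = if m ≤ n then x else y := by
  split_ifs with h
  · exact sifLe_of_le h x y
  · exact sifLe_of_lt (not_le.1 h) x y

/-! ### Finite sequences -/

def slen (s : M.C (Ty.seq σ)) : M.C Ty.nat := (lenC σ).val Env.nil ⬩ s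

def sshift (x : M.C σ) (α : M.C (Ty.nat ⇒ σ)) : M.C (Ty.nat ⇒ σ) := (shiftC σ).val Env.nil ⬩ x ⬩ α

def spre (s : M.C (Ty.seq σ)) (α : M.C (Ty.nat ⇒ σ)) : M.C (Ty.nat ⇒ σ) :=
  (preC σ).val Env.nil ⬩ s ⬩ α

def ssnoc (s : M.C (Ty.seq σ)) (x : M.C σ) : M.C (Ty.seq σ) := (snocC σ).val Env.nil ⬩ s ⬩ x

/-- The sequence `00…` of a structure. -/
def szeros : M.C ty1 := (zeroOf ty1).val Env.nil

section

omit hM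

@[simp] theorem val_len (e : Env M Γ) (s : Tm Γ (Ty.seq σ)) : (len s).val e = slen (s.val e) := by
  simp [len, slen]
@[simp] theorem val_shift (e : Env M Γ) (x : Tm Γ σ) (α : Tm Γ (Ty.nat ⇒ σ)) :
    (shift x α).val e = sshift (x.val e) (α.val e) := by
  simp [shift, sshift]
@[simp] theorem val_pre (e : Env M Γ) (s : Tm Γ (Ty.seq σ)) (α : Tm Γ (Ty.nat ⇒ σ)) :
    (pre s α).val e = spre (s.val e) (α.val e) := by
  simp [pre, spre]
@[simp] theorem val_snoc (e : Env M Γ) (s : Tm Γ (Ty.seq σ)) (x : Tm Γ σ) :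
    (snoc s x).val e = ssnoc (s.val e) (x.val e) := by
  simp [snoc, ssnoc]
@[simp] theorem val_zeros (e : Env M Γ) : zeros.val e = szeros := by
  simp [zeros, szeros]
@[simp] theorem val_get (e : Env M Γ) (s : Tm Γ natSeq) (i : Tm Γ Ty.nat) :
    (get s i).val e = spre (s.val e) szeros ⬩ i.val e := by
  simp [get, szeros]

end

@[simp] theorem szeros_app (n : M.C Ty.nat) : szeros ⬩ n = 0 := by
  simp [szeros, zeroOf]

@[simp] theorem slen_nil : slen (snil : M.C (Ty.seq σ)) = 0 := by simp [slen, lenC]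
@[simp] theorem slen_cons (a : M.C σ) (s : M.C (Ty.seq σ)) : slen (scons a s) = ns (slen s) := by
  simp [slen, lenC]
  exact congrArg _ (funext_app fun _ => funext_app fun _ => by simp)
@[simp] theorem sshift_zero (x : M.C σ) (α : M.C (Ty.nat ⇒ σ)) : sshift x α ⬩ 0 = x := by
  simp [sshift, shiftC]
@[simp] theorem sshift_ns (x : M.C σ) (α : M.C (Ty.nat ⇒ σ)) (n : M.C Ty.nat) :
    sshift x α ⬩ ns n = α ⬩ n := by
  simp [sshift, shiftC]
@[simp] theorem spre_nil (α : M.C (Ty.nat ⇒ σ)) : spre snil α = α := by simp [spre, preC]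
@[simp] theorem spre_cons (a : M.C σ) (s : M.C (Ty.seq σ)) (α : M.C (Ty.nat ⇒ σ)) :
    spre (scons a s) α = sshift a (spre s α) := by
  simp [spre, preC]
  exact congrArg _ (congrArg _ (funext_app fun _ => funext_app fun _ => by simp))
@[simp] theorem ssnoc_nil (x : M.C σ) : ssnoc snil x = scons x snil := by simp [ssnoc, snocC]
@[simp] theorem ssnoc_cons (a : M.C σ) (s : M.C (Ty.seq σ)) (x : M.C σ) :
    ssnoc (scons a s) x = scons a (ssnoc s x) := by
  simp [ssnoc, snocC]
  exact congrArg _ (congrArg _ (funext_app fun _ => funext_app fun _ => by simp))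

/-- `P` has no induction axiom for sequences. It follows from induction on the length, since a
sequence is empty or has a first element and prepending raises the length by one. -/
theorem seq_ind (A : Fm (Ty.seq σ :: Γ)) (e : Env M Γ) (hA : A.Internal)
    (h0 : A.Sat (Env.cons snil e))
    (hs : ∀ a s, A.Sat (Env.cons s e) → A.Sat (Env.cons (scons a s) e)) (s : M.C (Ty.seq σ)) :
    A.Sat (Env.cons s e) := by
  let θ : Sub (Ty.seq σ :: Γ) (Ty.seq σ :: Ty.nat :: Γ) :=
    Sub.cons v0 fun _ v => Tm.var (Var.s (Var.s v))
  have key : ∀ n s, slen s = n → A.Sat (Env.cons s e) := by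
    have henv : ∀ n s, θ.env (Env.cons s (Env.cons n e)) = Env.cons s e := fun n s =>
      Env.ext_cons rfl fun _ _ => rfl
    have := nat_ind (Fm.all (Ty.seq σ) (len v0 ≐ v1 ⇾ A.subst θ)) e
      (by simpa using hA.subst θ)
      (fun s => by
        simp only [sat_imp, sat_eq, val_len, val_v0, val_v1, sat_subst, henv]
        intro h
        obtain rfl | ⟨a, t, rfl⟩ := seq_cases s
        · exact h0
        · simp at h)
      (fun n ih s => by
        simp only [sat_all, sat_imp, sat_eq, val_len, val_v0, val_v1, sat_subst, henv] at ih ⊢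
        intro h
        obtain rfl | ⟨a, t, rfl⟩ := seq_cases s
        · exact (ns_ne_zero n (by rw [← h, slen_nil])).elim
        · rw [slen_cons, ns_inj] at h
          exact hs a t (ih t h))
    simpa only [sat_all, sat_imp, sat_eq, val_len, val_v0, val_v1, sat_subst, henv] using this
  exact key _ s rfl

theorem spre_app_congr (s : M.C (Ty.seq σ)) (α β : M.C (Ty.nat ⇒ σ)) :
    ∀ n, n < slen s → spre s α ⬩ n = spre s β ⬩ n := by
  have := seq_ind (Fm.all Ty.nat (lt v0 (len v1) ⇾ pre v1 v2 ⬝ v0 ≐ pre v1 v3 ⬝ v0))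
    (Env.cons α (Env.cons β Env.nil)) (by simp)
    (fun n => by simp [← not_le, nat_zero_le])
    (fun a s ih n => by
      simp only [sat_all, sat_imp, sat_eq, sat_lt, val_app, val_pre, val_len, val_v0, val_v1,
        val_v2, val_v3, slen_cons, spre_cons] at ih ⊢
      obtain rfl | ⟨n, rfl⟩ := nat_cases n
      · simp
      · simpa [← ns_le_iff, ns_le_ns] using ih n) s
  simpa using this

theorem spre_snoc (s : M.C (Ty.seq σ)) (x : M.C σ) (α : M.C (Ty.nat ⇒ σ)) :
    spre (ssnoc s x) α = spre s (sshift x α) := by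
  have := seq_ind (pre (snoc v0 v1) v2 ≐ pre v0 (shift v1 v2))
    (Env.cons x (Env.cons α Env.nil)) (by simp) (by simp)
    (fun a s ih => by simpa using congrArg (sshift a) ih) s
  simpa using this

theorem slen_snoc (s : M.C (Ty.seq σ)) (x : M.C σ) : slen (ssnoc s x) = ns (slen s) := by
  have := seq_ind (len (snoc v0 v1) ≐ suc (len v0))
    (Env.cons x Env.nil) (by simp) (by simp) (by simp +contextual) s
  simpa using this

theorem spre_szeros_app (s : M.C natSeq) : ∀ n, slen s ≤ n → spre s szeros ⬩ n = 0 := by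
  have := seq_ind (Fm.all Ty.nat (le (len v1) v0 ⇾ pre v1 zeros ⬝ v0 ≐ zero))
    (Env.nil (M := M)) (by simp) (by simp)
    (fun a s ih n => by
      simp only [sat_all, sat_imp, sat_eq, sat_le, val_app, val_pre, val_len, val_zeros, val_zero,
        val_v0, val_v1, slen_cons, spre_cons] at ih ⊢
      obtain rfl | ⟨n, rfl⟩ := nat_cases n
      · simp [nat_le_zero]
      · simpa [ns_le_ns] using ih n) s
  simpa using this

end Model

/-! ### The recursion equations of `G` and `H` in models -/

section Equations

variable {M : Str} {Γ : Ctx}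

def strunc (s : M.C natSeq) (N : M.C Ty.nat) : M.C ty1 := truncC.val Env.nil ⬩ s ⬩ N

def sG (Y : M.C ty2) (s : M.C natSeq) (N : M.C Ty.nat) : M.C Ty.nat := G.val Env.nil ⬩ Y ⬩ s ⬩ N

def sH (Y : M.C ty2) (s : M.C natSeq) (N : M.C Ty.nat) : M.C Ty.nat := H.val Env.nil ⬩ Y ⬩ s ⬩ N

@[simp] theorem val_trunc (e : Env M Γ) (s : Tm Γ natSeq) (N : Tm Γ Ty.nat) :
    (trunc s N).val e = strunc (s.val e) (N.val e) := by
  simp [trunc, strunc]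

@[simp] theorem val_appG (e : Env M Γ) (Y : Tm Γ ty2) (s : Tm Γ natSeq) (N : Tm Γ Ty.nat) :
    (appG Y s N).val e = sG (Y.val e) (s.val e) (N.val e) := by
  simp [appG, sG]

@[simp] theorem val_appH (e : Env M Γ) (Y : Tm Γ ty2) (s : Tm Γ natSeq) (N : Tm Γ Ty.nat) :
    (appH Y s N).val e = sH (Y.val e) (s.val e) (N.val e) := by
  simp [appH, sH]

variable [hM : M.IsModel]

theorem strunc_app (s : M.C natSeq) (N n : M.C Ty.nat) :
    strunc s N ⬩ n = if n ≤ N then spre s szeros ⬩ n else 0 := by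
  simp [strunc, truncC, sifLe_eq]

/-- Cutting after entry `N` removes only zeros. This brings the base case of `H` to the form `Y(s *
α)` when `|s| = N`. -/
theorem strunc_eq (s : M.C natSeq) (N : M.C Ty.nat) (h : slen s ≤ N) :
    strunc s N = spre s szeros := by
  refine funext_app fun n => ?_
  rw [strunc_app]
  split_ifs with hn
  · rfl
  · exact (spre_szeros_app s n (h.trans (not_le.1 hn).le)).symm

theorem exists_nsub_eq_ns {m n : M.C Ty.nat} (h : n < m) : ∃ k, nsub m n = ns k := by
  obtain h0 | h1 := nat_cases (nsub m n)
  · exact (not_le.2 h h0).elim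
  · exact h1

/-- The base of the recursion that defines `G`. -/
def baseG : Tm [Ty.nat, natSeq, ty2] (natSeq ⇒ Ty.nat) := Tm.lam (v3 ⬝ pre v0 zeros)

/-- The step of the recursion that defines `G`. -/
def stepG : Tm [Ty.nat, natSeq, ty2] ((natSeq ⇒ Ty.nat) ⇒ Ty.nat ⇒ natSeq ⇒ Ty.nat) :=
  Tm.lam (Tm.lam (Tm.lam (v5 ⬝ pre v0 (shift zero (Tm.lam (v3 ⬝ snoc v1 (suc v0)))))))

/-- The base and the step inside `G` are evaluated in an environment that contains `s`, though they
do not depend on it. Putting `snil` there, by extensionality, lets one recursor serve both `s` and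
its extensions. -/
theorem sG_eq (Y : M.C ty2) (s : M.C natSeq) (N : M.C Ty.nat) : sG Y s N =
    M.cst (Cst.recN _) ⬩ nsub N (slen s) ⬩
      baseG.val (Env.cons N (Env.cons snil (Env.cons Y Env.nil))) ⬩
      stepG.val (Env.cons N (Env.cons snil (Env.cons Y Env.nil))) ⬩ s := by
  have hb : baseG.val (Env.cons N (Env.cons s (Env.cons Y Env.nil))) =
      baseG.val (Env.cons N (Env.cons snil (Env.cons Y Env.nil))) :=
    funext_app fun _ => by simp [baseG]
  have hs : stepG.val (Env.cons N (Env.cons s (Env.cons Y Env.nil))) =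
      stepG.val (Env.cons N (Env.cons snil (Env.cons Y Env.nil))) := by
    refine funext_app fun R => funext_app fun m => funext_app fun s => ?_
    simp only [stepG, lam_app, val_app, val_pre, val_shift, val_zero, val_v0, val_v5]
    exact congrArg _ (congrArg _ (congrArg _ (funext_app fun _ => by simp)))
  rw [← hb, ← hs]
  simp only [sG, G, lam_app, val_app, val_natRec, val_sub, val_len, val_v0, val_v1, baseG, stepG]

theorem sG_of_le (Y : M.C ty2) {s : M.C natSeq} {N : M.C Ty.nat} (h : N ≤ slen s) :
    sG Y s N = Y ⬩ spre s szeros := by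
  rw [sG_eq, (nat_le_def _ _).1 h]
  simp [baseG]

theorem sG_of_lt (Y : M.C ty2) {s : M.C natSeq} {N : M.C Ty.nat} (h : slen s < N) :
    ∃ β, sG Y s N = Y ⬩ spre s (sshift 0 β) ∧ ∀ n, β ⬩ n = sG Y (ssnoc s (ns n)) N := by
  obtain ⟨m, hm⟩ := exists_nsub_eq_ns h
  rw [sG_eq, hm, recN_suc]
  simp only [stepG, lam_app, val_app, val_pre, val_shift, val_zero, val_v0, val_v5]
  refine ⟨_, rfl, fun n => ?_⟩
  -- One more entry lowers the counter `N ∸ |s|` from `m + 1` to `m`, which is where the recursor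
  -- evaluates its previous value.
  rw [sG_eq, slen_snoc, nsub_ns, hm, npred_ns]
  simp [stepG]

/-- The base of the recursion that defines `H`. -/
def baseH : Tm [Ty.nat, natSeq, ty2] (natSeq ⇒ Ty.nat) := Tm.lam (v3 ⬝ trunc v0 v1)

/-- The step of the recursion that defines `H`. -/
def stepH : Tm [Ty.nat, natSeq, ty2] ((natSeq ⇒ Ty.nat) ⇒ Ty.nat ⇒ natSeq ⇒ Ty.nat) :=
  Tm.lam (Tm.lam (Tm.lam (v5 ⬝ pre v0 (shift zero
    (Tm.lam (ifLe (suc v0) v4 (v3 ⬝ snoc v1 (suc v0)) zero))))))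

theorem sH_eq (Y : M.C ty2) (s : M.C natSeq) (N : M.C Ty.nat) : sH Y s N =
    M.cst (Cst.recN _) ⬩ nsub N (slen s) ⬩
      baseH.val (Env.cons N (Env.cons snil (Env.cons Y Env.nil))) ⬩
      stepH.val (Env.cons N (Env.cons snil (Env.cons Y Env.nil))) ⬩ s := by
  have hb : baseH.val (Env.cons N (Env.cons s (Env.cons Y Env.nil))) =
      baseH.val (Env.cons N (Env.cons snil (Env.cons Y Env.nil))) :=
    funext_app fun _ => by simp [baseH]
  have hs : stepH.val (Env.cons N (Env.cons s (Env.cons Y Env.nil))) =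
      stepH.val (Env.cons N (Env.cons snil (Env.cons Y Env.nil))) := by
    refine funext_app fun R => funext_app fun m => funext_app fun s => ?_
    simp only [stepH, lam_app, val_app, val_pre, val_shift, val_zero, val_v0, val_v5]
    exact congrArg _ (congrArg _ (congrArg _ (funext_app fun _ => by simp)))
  rw [← hb, ← hs]
  simp only [sH, H, lam_app, val_app, val_natRec, val_sub, val_len, val_v0, val_v1, baseH, stepH]

theorem sH_of_le (Y : M.C ty2) {s : M.C natSeq} {N : M.C Ty.nat} (h : N ≤ slen s) :
    sH Y s N = Y ⬩ strunc s N := by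
  rw [sH_eq, (nat_le_def _ _).1 h]
  simp [baseH]

theorem sH_of_lt (Y : M.C ty2) {s : M.C natSeq} {N : M.C Ty.nat} (h : slen s < N) :
    ∃ β, sH Y s N = Y ⬩ spre s (sshift 0 β) ∧
      ∀ n, β ⬩ n = sifLe (ns n) N (sH Y (ssnoc s (ns n)) N) 0 := by
  obtain ⟨m, hm⟩ := exists_nsub_eq_ns h
  rw [sH_eq, hm, recN_suc]
  simp only [stepH, lam_app, val_app, val_pre, val_shift, val_zero, val_v0, val_v5]
  refine ⟨_, rfl, fun n => ?_⟩
  rw [sH_eq, slen_snoc, nsub_ns, hm, npred_ns]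
  simp [stepH]

theorem sat_defG : defG.Sat (Env.nil (M := M)) := by
  simp only [defG, sat_all, sat_and, sat_imp, sat_neg, sat_le, sat_eq, val_v0, val_v1, val_v2,
    val_appG, val_app, val_len, val_pre, val_shift, val_zeros, val_zero]
  refine fun Y s N => ⟨sG_of_le Y, fun h => ?_⟩
  obtain ⟨β, h₁, h₂⟩ := sG_of_lt Y (not_le.1 h)
  rw [h₁]
  exact congrArg _ (congrArg _ (congrArg _ (funext_app fun n => by simp [h₂])))

theorem sat_defH : defH.Sat (Env.nil (M := M)) := by
  simp only [defH, sat_all, sat_and, sat_imp, sat_neg, sat_le, sat_eq, val_v0, val_v1, val_v2,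
    val_appH, val_app, val_len, val_pre, val_shift, val_trunc, val_zero]
  refine fun Y s N => ⟨sH_of_le Y, fun h => ?_⟩
  obtain ⟨β, h₁, h₂⟩ := sH_of_lt Y (not_le.1 h)
  rw [h₁]
  exact congrArg _ (congrArg _ (congrArg _ (funext_app fun n => by simp [h₂])))

end Equations

/-! ### Standard objects -/

section Standard

variable {M : Str} {Γ : Ctx} {ρ σ τ : Ty}

/-- All values of the environment are standard. -/
def Env.St (e : Env M Γ) : Prop := ∀ σ v, M.st (e σ v)

theorem Env.St.nil : (Env.nil : Env M []).St := fun _ v => by cases v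

theorem Env.St.cons {a : M.C ρ} {e : Env M Γ} (ha : M.st a) (he : e.St) : (Env.cons a e).St := by
  intro σ v
  cases v with
  | z => exact ha
  | s v => exact he _ v

variable [hM : M.IsModel]

theorem st_app {f : M.C (σ ⇒ τ)} {x : M.C σ} (hf : M.st f) (hx : M.st x) : M.st (f ⬩ x) := by
  have := hM.sat (Axm.st_app v0 v1) (Env.cons f (Env.cons x Env.nil))
  simp only [sat_imp, sat_and, sat_st, val_app, val_v0, val_v1] at this
  exact this ⟨hf, hx⟩

theorem st_closed (t : Tm [] σ) : M.st (t.val Env.nil) := by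
  have := hM.sat (Axm.st_closed t) (Env.nil (M := M))
  simpa using this

theorem st_val {e : Env M Γ} (he : e.St) (t : Tm Γ σ) : M.st (t.val e) := by
  induction t with
  | var v => exact he _ v
  | cst k => exact st_closed (Tm.cst k)
  | app t u iht ihu => exact st_app iht ihu

theorem st_zero : M.st (0 : M.C Ty.nat) := st_closed zero

theorem st_ns {n : M.C Ty.nat} (h : M.st n) : M.st (ns n) := st_app (st_closed (Tm.cst Cst.succ)) h

/-- The property mentions standardness, so external induction on the standard bound is what applies.
-/
theorem st_of_le {n : M.C Ty.nat} (hn : M.st n) : ∀ m, m ≤ n → M.st m := by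
  have := nat_ind_st (Fm.all Ty.nat (le v0 v1 ⇾ Fm.st v0)) (Env.nil (M := M))
    (by simp [nat_le_zero, st_zero])
    (fun n _ ih m => by
      simp only [sat_all, sat_imp, sat_le, sat_st, val_v0, val_v1] at ih ⊢
      intro h
      obtain rfl | ⟨k, rfl⟩ := nat_cases m
      · exact st_zero
      · exact st_ns (ih k (ns_le_ns.1 h))) n hn
  simpa using this

theorem lt_of_st {m n : M.C Ty.nat} (hm : M.st m) (hn : ¬ M.st n) : m < n :=
  not_le.1 fun h => hn (st_of_le hm n h)

/-- Underspill. -/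
theorem exists_st_of_forall_not_st (A : Fm (Ty.nat :: Γ)) (e : Env M Γ) (hA : A.Internal)
    {ω : M.C Ty.nat} (hω : ¬ M.st ω) (h : ∀ k, ¬ M.st k → A.Sat (Env.cons k e)) :
    ∃ k, M.st k ∧ A.Sat (Env.cons k e) := by
  by_contra! hcon
  -- Internal induction on `k` shows `A` at `ω ∸ k`, descending from `ω` to `0`. If `ω ∸ (k + 1)`
  -- were standard, so would be `ω ∸ k`, where `A` holds, against `hcon`; hence it is nonstandard
  -- and `h` applies.
  let θ : Sub (Ty.nat :: Γ) (Ty.nat :: Ty.nat :: Γ) :=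
    Sub.cons (sub v1 v0) fun _ v => Tm.var (Var.s (Var.s v))
  have henv : ∀ k, θ.env (Env.cons k (Env.cons ω e)) = Env.cons (nsub ω k) e := fun k =>
    Env.ext_cons (val_sub _ _ _) fun _ _ => rfl
  have := nat_ind (A.subst θ) (Env.cons ω e) (hA.subst θ)
    (by rw [sat_subst, henv, nsub_zero]; exact h ω hω)
    (fun k ih => by
      rw [sat_subst, henv] at ih ⊢
      rw [nsub_ns]
      refine h _ fun hst => ?_
      obtain h0 | ⟨m, hm⟩ := nat_cases (nsub ω k)
      · exact hcon _ (h0 ▸ st_zero) ih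
      · refine hcon _ ?_ ih
        rw [hm, npred_ns] at hst
        exact hm ▸ st_ns hst) ω
  rw [sat_subst, henv, nsub_self] at this
  exact hcon 0 st_zero this

omit hM in
@[simp] theorem sat_mem (e : Env M Γ) [M.IsModel] (x : Tm Γ Ty.nat) (s : Tm Γ natSeq) :
    (mem x s).Sat e ↔ ∃ i, i < slen (s.val e) ∧ spre (s.val e) szeros ⬩ i = x.val e := by
  simp [mem]

/-- Herbrandised choice of numbers. -/
theorem exists_st_choice (A : Fm (Ty.nat :: ρ :: Γ)) (e : Env M Γ) (hA : A.Internal)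
    (h : ∀ x, M.st x → ∃ y, M.st y ∧ A.Sat (Env.cons y (Env.cons x e))) :
    ∃ F : M.C (ρ ⇒ natSeq), M.st F ∧ ∀ x, M.st x → ∃ i, i < slen (F ⬩ x) ∧
      A.Sat (Env.cons (spre (F ⬩ x) szeros ⬩ i) (Env.cons x e)) := by
  have := hM.sat (Axm.hac A hA) e
  simp only [sat_imp, sat_allSt, sat_exSt, sat_ex, sat_and, sat_mem, sat_rename_wk_lift_lift,
    val_app, val_v0, val_v1, val_v2] at this
  obtain ⟨F, hF, hF'⟩ := this h
  refine ⟨F, hF, fun x hx => ?_⟩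
  obtain ⟨y, ⟨i, hi, rfl⟩, hy⟩ := hF' x hx
  exact ⟨i, hi, hy⟩

/-! ### Search in finite sequences -/

/-- The maximum of a finite sequence. -/
def maxC : Tm [] (natSeq ⇒ Ty.nat) :=
  Tm.lam (seqRec v0 zero (Tm.lam (Tm.lam (ifLe v1 v0 v0 v1))))

/-- An entry of the sequence at which the function is not zero, if there is one. -/
def searchC : Tm [] (ty1 ⇒ natSeq ⇒ Ty.nat) :=
  Tm.lam (Tm.lam (seqRec v0 zero (Tm.lam (Tm.lam (ifLe (v3 ⬝ v0) zero v1 v0)))))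

def smax (s : M.C natSeq) : M.C Ty.nat := maxC.val Env.nil ⬩ s

def ssearch (f : M.C ty1) (s : M.C natSeq) : M.C Ty.nat := searchC.val Env.nil ⬩ f ⬩ s

theorem smax_cons (a : M.C Ty.nat) (s : M.C natSeq) :
    smax (scons a s) = if smax s ≤ a then a else smax s := by
  have : ∀ t : M.C natSeq, (Tm.lam (Tm.lam (ifLe v1 v0 v0 v1))).val (Env.cons t Env.nil) =
      (Tm.lam (Tm.lam (ifLe v1 v0 v0 v1)) : Tm [] (Ty.nat ⇒ Ty.nat ⇒ Ty.nat)).val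
        (Env.nil (M := M)) := fun t => funext_app fun _ => funext_app fun _ => by simp
  simp only [smax, maxC, lam_app, val_seqRec, val_v0, val_v1, val_zero, this, recL_cons, val_ifLe,
    sifLe_eq]

theorem ssearch_cons (f : M.C ty1) (a : M.C Ty.nat) (s : M.C natSeq) :
    ssearch f (scons a s) = if f ⬩ a = 0 then ssearch f s else a := by
  have : ∀ t : M.C natSeq, (Tm.lam (Tm.lam (ifLe (v3 ⬝ v0) zero v1 v0))).val
      (Env.cons t (Env.cons f Env.nil)) = (Tm.lam (Tm.lam (ifLe (v2 ⬝ v0) zero v1 v0))).val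
      (Env.cons f Env.nil) := fun t => funext_app fun _ => funext_app fun _ => by simp
  simp only [ssearch, searchC, lam_app, val_seqRec, val_v0, this, recL_cons, val_ifLe, val_app,
    val_v1, val_v2, val_zero, sifLe_eq, nat_le_zero]

theorem le_smax (s : M.C natSeq) : ∀ i, i < slen s → spre s szeros ⬩ i ≤ smax s := by
  have := seq_ind (Fm.all Ty.nat (lt v0 (len v1) ⇾ le (pre v1 zeros ⬝ v0) (maxC.ofClosed ⬝ v1)))
    (Env.nil (M := M)) (by simp)
    (fun i => by simp [← not_le, nat_zero_le])
    (fun a s ih i => by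
      simp only [sat_all, sat_imp, sat_lt, sat_le, val_app, val_pre, val_len, val_v0, val_v1,
        val_zeros, val_ofClosed, slen_cons, spre_cons] at ih ⊢
      change _ → _ ≤ smax _
      change ∀ i, _ → _ ≤ smax _ at ih
      rw [smax_cons]
      intro hi
      obtain rfl | ⟨i, rfl⟩ := nat_cases i
      · rw [sshift_zero]
        split_ifs with h
        · exact le_rfl
        · exact (not_le.1 h).le
      · rw [sshift_ns]
        have := ih i (by rwa [← ns_le_iff, ns_le_ns, ns_le_iff] at hi)
        split_ifs with h
        · exact this.trans h
        · exact this) s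
  simpa [smax] using this

theorem ssearch_spec (f : M.C ty1) (s : M.C natSeq) :
    ∀ i, i < slen s → f ⬩ (spre s szeros ⬩ i) ≠ 0 → f ⬩ ssearch f s ≠ 0 := by
  have := seq_ind (Fm.all Ty.nat (lt v0 (len v1) ⇾ (v2 ⬝ (pre v1 zeros ⬝ v0) ≐ zero).neg ⇾
      (v2 ⬝ (searchC.ofClosed ⬝ v2 ⬝ v1) ≐ zero).neg))
    (Env.cons f Env.nil) (by simp)
    (fun i => by simp [← not_le, nat_zero_le])
    (fun a s ih i => by
      simp only [sat_all, sat_imp, sat_lt, sat_neg, sat_eq, val_app, val_pre, val_len, val_v0,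
        val_v1, val_v2, val_zero, val_zeros, val_ofClosed, slen_cons, spre_cons] at ih ⊢
      change _ → _ → ¬ _ ⬩ ssearch _ _ = _
      change ∀ i, _ → _ → ¬ _ ⬩ ssearch _ _ = _ at ih
      rw [ssearch_cons]
      intro hi
      obtain rfl | ⟨i, rfl⟩ := nat_cases i
      · rw [sshift_zero]
        intro h
        rwa [if_neg h]
      · rw [sshift_ns]
        intro h'
        have := ih i (by rwa [← ns_le_iff, ns_le_ns, ns_le_iff] at hi) h'
        split_ifs with h
        · exact this
        · exact h) s
  simpa [ssearch] using this

end Standard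

/-! ### Transfer from nonstandard continuity -/

section Transfer

variable {M : Str}

/-- The semantic content of `Y ∈ C`. -/
def Cont (Y : M.C ty2) : Prop :=
  ∀ f, ∃ N : M.C Ty.nat, ∀ g, (∀ n, n ≤ N → g ⬩ n = f ⬩ n) → Y ⬩ f = Y ⬩ g

/-- The semantic content of `NPC`. -/
def Str.NPC (M : Str) : Prop :=
  ∀ Y : M.C ty2, M.st Y → Cont Y → ∀ f, M.st f → ∀ g, (∀ n, M.st n → f ⬩ n = g ⬩ n) →
    Y ⬩ f = Y ⬩ g

@[simp] theorem sat_agree {Γ : Ctx} (e : Env M Γ) (f g : Tm Γ ty1) (N : Tm Γ Ty.nat) :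
    (agree f g N).Sat e ↔ ∀ n, n ≤ N.val e → f.val e ⬩ n = g.val e ⬩ n := by
  simp [agree]

@[simp] theorem sat_cont {Γ : Ctx} (e : Env M Γ) (Y : Tm Γ ty2) :
    (cont Y).Sat e ↔ Cont (Y.val e) := by
  simp [cont, Cont]

theorem sat_NPC : PSys.NPC.Sat (Env.nil (M := M)) ↔ M.NPC := by
  simp [PSys.NPC, Str.NPC, approx]

variable [hM : M.IsModel]

/-- A standard modulus of continuity at a standard point. -/
theorem exists_st_modulus (hN : M.NPC) {ω : M.C Ty.nat} (hω : ¬ M.st ω) {Y : M.C ty2}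
    (hY : M.st Y) (hc : Cont Y) {f : M.C ty1} (hf : M.st f) :
    ∃ N, M.st N ∧ ∀ g, (∀ n, n ≤ N → g ⬩ n = f ⬩ n) → Y ⬩ f = Y ⬩ g := by
  -- Agreement up to a nonstandard `k` includes all standard arguments, so by NPC every nonstandard
  -- `k` is a modulus, and underspill finds a standard one.
  have := exists_st_of_forall_not_st (Fm.all ty1 (agree v0 v2 v1 ⇾ v3 ⬝ v2 ≐ v3 ⬝ v0))
    (Env.cons f (Env.cons Y Env.nil)) (by simp) hω (fun k hk => by
      simp only [sat_all, sat_imp, sat_agree, sat_eq, val_app, val_v0, val_v1, val_v2, val_v3]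
      exact fun g hg => hN Y hY hc f hf g fun n hn => (hg n (lt_of_st hn hk).le).symm)
  simpa using this

/-- `λ p q h. q (h (p + 1))`. -/
def evalC : Tm [] (Ty.nat ⇒ ty1 ⇒ ty2) := Tm.lam (Tm.lam (Tm.lam (v1 ⬝ (v0 ⬝ suc v2))))

/-- The function that is `0` where `d` is, and otherwise equals `g`. -/
def maskC : Tm [] (ty1 ⇒ ty1 ⇒ ty1) :=
  Tm.lam (Tm.lam (Tm.lam (ifLe (v2 ⬝ v0) zero zero (v1 ⬝ v0))))

/-- `0` at `n` if and only if `f` vanishes below `n`. -/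
def seenC : Tm [] (ty1 ⇒ ty1) :=
  Tm.lam (Tm.lam (natRec v0 zero (Tm.lam (Tm.lam (ifLe v1 zero (v3 ⬝ v0) v1)))))

/-- The restriction of `f` to the first place where it is not `0`. -/
def firstC : Tm [] (ty1 ⇒ ty1) :=
  Tm.lam (Tm.lam (ifLe (seenC.ofClosed ⬝ v1 ⬝ v0) zero (v1 ⬝ v0) zero))

/-- The functional that is discontinuous at `00…` for a function `d` whose only nonzero value is at
a nonstandard argument. -/
def detectC : Tm [] ((ty2 ⇒ natSeq) ⇒ Ty.nat ⇒ ty1 ⇒ ty2) :=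
  Tm.lam (Tm.lam (Tm.lam (Tm.lam
    (maxC.ofClosed ⬝ (v3 ⬝ (evalC.ofClosed ⬝ v2 ⬝ (maskC.ofClosed ⬝ v1 ⬝ v0)))))))

def sseen (f : M.C ty1) : M.C ty1 := seenC.val Env.nil ⬩ f
def sfirst (f : M.C ty1) : M.C ty1 := firstC.val Env.nil ⬩ f
def smask (d g : M.C ty1) : M.C ty1 := maskC.val Env.nil ⬩ d ⬩ g
def seval (p : M.C Ty.nat) (q : M.C ty1) : M.C ty2 := evalC.val Env.nil ⬩ p ⬩ q

theorem sseen_zero (f : M.C ty1) : sseen f ⬩ 0 = 0 := by simp [sseen, seenC]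

theorem sseen_ns (f : M.C ty1) (n : M.C Ty.nat) :
    sseen f ⬩ ns n = if sseen f ⬩ n = 0 then f ⬩ n else sseen f ⬩ n := by
  have : ∀ t : M.C Ty.nat, (Tm.lam (Tm.lam (ifLe v1 zero (v3 ⬝ v0) v1))).val
      (Env.cons t (Env.cons f Env.nil)) = (Tm.lam (Tm.lam (ifLe v1 zero (v2 ⬝ v0) v1))).val
      (Env.cons f Env.nil) := fun t => funext_app fun _ => funext_app fun _ => by simp
  simp only [sseen, seenC, lam_app, val_natRec, val_v0, val_zero, this, recN_suc, val_ifLe,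
    sifLe_eq, nat_le_zero, val_v1, val_v2, val_app]

theorem sfirst_app (f : M.C ty1) (n : M.C Ty.nat) :
    sfirst f ⬩ n = if sseen f ⬩ n = 0 then f ⬩ n else 0 := by
  simp [sfirst, firstC, sseen, sifLe_eq, nat_le_zero]
  rfl

theorem smask_app (d g : M.C ty1) (n : M.C Ty.nat) :
    smask d g ⬩ n = if d ⬩ n = 0 then 0 else g ⬩ n := by
  simp [smask, maskC, sifLe_eq, nat_le_zero]

theorem seval_app (p : M.C Ty.nat) (q h : M.C ty1) : seval p q ⬩ h = q ⬩ (h ⬩ ns p) := by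
  simp [seval, evalC]

/-- Once `sseen f` has met a nonzero value of `f` it keeps that value, so being zero at `k` excludes
any earlier one. -/
theorem eq_zero_of_sseen (f : M.C ty1) (k : M.C Ty.nat) :
    sseen f ⬩ k = 0 → ∀ n, n < k → f ⬩ n = 0 := by
  have := nat_ind ((seenC.ofClosed ⬝ v1 ⬝ v0 ≐ zero) ⇾
      Fm.all Ty.nat (lt v0 v1 ⇾ v2 ⬝ v0 ≐ zero)) (Env.cons f Env.nil) (by simp)
    (by simp [← not_le, nat_zero_le])
    (fun k ih => by
      simp only [sat_all, sat_imp, sat_eq, sat_lt, val_app, val_ofClosed, val_v0, val_v1, val_v2,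
        val_zero] at ih ⊢
      change sseen _ ⬩ _ = _ → _ at ih
      change sseen _ ⬩ _ = _ → _
      rw [sseen_ns]
      intro h n hn
      split_ifs at h with h0
      · obtain hn | rfl := (nat_lt_ns.1 hn).lt_or_eq
        · exact ih h0 n hn
        · exact h
      · exact (h0 h).elim) k
  simpa [sseen] using this

theorem sfirst_eq_zero_of_lt {f : M.C ty1} {w k : M.C Ty.nat} (hw : sfirst f ⬩ w ≠ 0)
    (h : w < k) : sfirst f ⬩ k = 0 := by
  rw [sfirst_app]
  split_ifs with h0
  · refine (hw ?_).elim
    rw [sfirst_app, eq_zero_of_sseen f k h0 w h, ite_self]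
  · rfl

theorem eq_zero_of_sfirst {f : M.C ty1} (h : ∀ n, sfirst f ⬩ n = 0) (n : M.C Ty.nat) :
    f ⬩ n = 0 := by
  have : ∀ n, sseen f ⬩ n = 0 := by
    have := nat_ind (seenC.ofClosed ⬝ v1 ⬝ v0 ≐ zero) (Env.cons f Env.nil) (by simp)
      (by simpa [sseen] using sseen_zero f)
      (fun k ih => by
        simp only [sat_eq, val_app, val_ofClosed, val_v0, val_v1, val_zero] at ih ⊢
        change sseen _ ⬩ _ = _ at ih
        change sseen _ ⬩ _ = _
        have := h k
        rw [sfirst_app, if_pos ih] at this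
        rw [sseen_ns, if_pos ih, this])
    simpa [sseen] using this
  have hn := h n
  rwa [sfirst_app, if_pos (this n)] at hn

theorem smask_self (d : M.C ty1) : smask d d = d := by
  refine funext_app fun n => ?_
  rw [smask_app]
  split_ifs with h
  · exact h.symm
  · rfl

theorem cont_seval (p : M.C Ty.nat) (q : M.C ty1) : Cont (seval p q) := fun f =>
  ⟨ns p, fun g hg => by rw [seval_app, seval_app, hg (ns p) (le_refl (ns p))]⟩

/-- A function that takes the value `w` at `p + 1` and `0` below. -/
theorem exists_jump (p w : M.C Ty.nat) :
    ∃ g : M.C ty1, (∀ n, n ≤ p → g ⬩ n = 0) ∧ g ⬩ ns p = w := by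
  refine ⟨(Tm.lam (ifLe v0 v1 zero v2)).val (Env.cons p (Env.cons w Env.nil)), fun n hn => ?_, ?_⟩
  · simpa using sifLe_of_le hn _ _
  · simpa using sifLe_of_lt (nat_lt_ns.2 le_rfl) _ _

/-- Choice returns a finite list with a modulus among its entries. A larger number is again a
modulus, so the maximum of the list will do. -/
theorem exists_st_modulus_zero (hN : M.NPC) {ω : M.C Ty.nat} (hω : ¬ M.st ω) :
    ∃ F : M.C (ty2 ⇒ natSeq), M.st F ∧ ∀ Y, M.st Y → Cont Y →
      ∀ g, (∀ n, n ≤ smax (F ⬩ Y) → g ⬩ n = 0) → Y ⬩ szeros = Y ⬩ g := by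
  obtain ⟨F, hF, h⟩ := exists_st_choice
    (cont v1 ⇾ Fm.all ty1 (agree v0 zeros v1 ⇾ v2 ⬝ zeros ≐ v2 ⬝ v0)) (Env.nil (M := M)) (by simp)
    (fun Y hY => by
      simp only [sat_imp, sat_cont, sat_all, sat_agree, sat_eq, val_app, val_zeros, val_v0, val_v1,
        val_v2]
      by_cases hc : Cont Y
      · obtain ⟨N, hN, h⟩ := exists_st_modulus hN hω hY hc (st_closed (zeroOf ty1))
        exact ⟨N, hN, fun _ => h⟩
      -- Choice needs a value at every standard `Y`; outside `C` any number is vacuously right.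
      · exact ⟨0, st_zero, fun h => (hc h).elim⟩)
  refine ⟨F, hF, fun Y hY hc g hg => ?_⟩
  obtain ⟨i, hi, h⟩ := h Y hY
  simp only [sat_imp, sat_cont, sat_all, sat_agree, sat_eq, val_app, val_zeros, val_v0, val_v1,
    val_v2] at h
  exact h hc g fun n hn => by rw [hg n (hn.trans (le_smax _ i hi)), szeros_app]

/-- Transfer: a standard function that vanishes at the standard numbers vanishes everywhere. -/
theorem eq_zero_of_forall_st (hN : M.NPC) {ω : M.C Ty.nat} (hω : ¬ M.st ω) {f : M.C ty1}
    (hf : M.st f) (h : ∀ n, M.st n → f ⬩ n = 0) (n : M.C Ty.nat) : f ⬩ n = 0 := by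
  obtain ⟨F, hF, hΨ⟩ := exists_st_modulus_zero hN hω
  refine eq_zero_of_sfirst (fun w => ?_) n
  by_contra hw
  -- Only the first nonzero value is kept, so that masking by `d` yields a functional continuous in
  -- the internal sense.
  let d : M.C ty1 := sfirst f
  have hd : M.st d := st_app (st_closed firstC) hf
  have hd0 : ∀ n, M.st n → d ⬩ n = 0 := fun n hn => by
    show sfirst f ⬩ n = 0
    rw [sfirst_app, h n hn, ite_self]
  let Y₀ : M.C ty2 := (zeroOf ty2).val Env.nil
  have hY₀ : M.st Y₀ := st_closed _
  let p : M.C Ty.nat := smax (F ⬩ Y₀)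
  have hp : M.st p := st_app (st_closed maxC) (st_app hF hY₀)
  let Z : M.C ty2 := detectC.val Env.nil ⬩ F ⬩ p ⬩ d
  have hZ : ∀ g, Z ⬩ g = smax (F ⬩ seval p (smask d g)) := fun g => by
    simp [Z, detectC, smax, seval, smask]
  have hZst : M.st Z := st_app (st_app (st_app (st_closed _) hF) hp) hd
  -- The modulus `w` is nonstandard, but membership in `C` is internal and does not ask for a
  -- standard one.
  have hZc : Cont Z := fun g => ⟨w, fun g' hg' => by
    rw [hZ, hZ]
    have : smask d g = smask d g' := funext_app fun k => by
      rw [smask_app, smask_app]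
      obtain hk | hk := le_or_gt k w
      · rw [hg' k hk]
      · rw [show d ⬩ k = 0 from sfirst_eq_zero_of_lt hw hk, if_pos rfl, if_pos rfl]
    rw [this]⟩
  have hZeq : Z ⬩ szeros = Z ⬩ d := hN Z hZst hZc szeros (st_closed (zeroOf ty1)) d fun n hn => by
    rw [hd0 n hn, szeros_app]
  have h0 : seval p (smask d szeros) = Y₀ := funext_app fun g => by
    rw [seval_app, smask_app, szeros_app, ite_self]
    simp [Y₀, zeroOf]
  rw [hZ, hZ, h0, smask_self] at hZeq
  -- By `hZeq`, `p` is also the modulus chosen for `seval p d`. The jump at `p + 1` escapes it, yet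
  -- changes the value from `d(0) = 0` to `d(w)`.
  obtain ⟨g, hg, hgw⟩ := exists_jump p w
  have := hΨ (seval p d) (st_app (st_app (st_closed evalC) hp) hd) (cont_seval p d) g
    fun n hn => hg n (by rwa [← hZeq] at hn)
  rw [seval_app, seval_app, szeros_app, hgw, hd0 0 st_zero] at this
  exact hw this.symm

/-- A standard functional that finds nonzero values of standard functions. -/
theorem exists_st_mu (hN : M.NPC) {ω : M.C Ty.nat} (hω : ¬ M.st ω) :
    ∃ μ : M.C ty2, M.st μ ∧ ∀ f, M.st f → ∀ m, f ⬩ m ≠ 0 → f ⬩ (μ ⬩ f) ≠ 0 := by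
  obtain ⟨F, hF, h⟩ := exists_st_choice
    (Fm.ex Ty.nat (v2 ⬝ v0 ≐ zero).neg ⇾ (v1 ⬝ v0 ≐ zero).neg) (Env.nil (M := M)) (by simp)
    (fun f hf => by
      simp only [sat_imp, sat_ex, sat_neg, sat_eq, val_app, val_zero, val_v0, val_v1, val_v2]
      by_cases hc : ∀ n, M.st n → f ⬩ n = 0
      -- Transfer enters here: without a standard place where `f` is nonzero there is no such place
      -- at all.
      · exact ⟨0, st_zero, fun ⟨m, hm⟩ => (hm (eq_zero_of_forall_st hN hω hf hc m)).elim⟩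
      · push Not at hc
        obtain ⟨n, hn, hfn⟩ := hc
        exact ⟨n, hn, fun _ => hfn⟩)
  refine ⟨(Tm.lam (searchC.ofClosed ⬝ v0 ⬝ (v1 ⬝ v0))).val (Env.cons F Env.nil),
    st_val (.cons hF .nil) _, fun f hf m hm => ?_⟩
  obtain ⟨i, hi, h⟩ := h f hf
  simp only [sat_imp, sat_ex, sat_neg, sat_eq, val_app, val_zero, val_v0, val_v1, val_v2] at h
  have := ssearch_spec f (F ⬩ f) i hi (h ⟨m, hm⟩)
  simpa [ssearch] using this

end Transfer

/-! ### Invariance -/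

section Invariance

/-- The type of the approximations with the functional argument fixed. -/
abbrev apxTy : Ty := natSeq ⇒ Ty.nat ⇒ Ty.nat

/-- `λ A s k N` is `0` if and only if `k ≤ N` implies `A s N = A s k`. -/
def differC : Tm [] (apxTy ⇒ natSeq ⇒ Ty.nat ⇒ ty1) :=
  Tm.lam (Tm.lam (Tm.lam (Tm.lam (ifLe v1 v0
    (ifLe (v3 ⬝ v2 ⬝ v0) (v3 ⬝ v2 ⬝ v1)
      (ifLe (v3 ⬝ v2 ⬝ v1) (v3 ⬝ v2 ⬝ v0) zero (suc zero)) (suc zero)) zero))))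

/-- `λ A μ s k`, which tests by means of `μ` whether `A s` is constant from `k` on. -/
def stableC : Tm [] (apxTy ⇒ ty2 ⇒ natSeq ⇒ ty1) :=
  Tm.lam (Tm.lam (Tm.lam (Tm.lam (ifLe
    (differC.ofClosed ⬝ v3 ⬝ v1 ⬝ v0 ⬝ (v2 ⬝ (differC.ofClosed ⬝ v3 ⬝ v1 ⬝ v0)))
      zero (suc zero) zero))))

/-- `λ A μ s`, a number from which on `A s` is constant, if there is one. -/
def limC : Tm [] (apxTy ⇒ ty2 ⇒ natSeq ⇒ Ty.nat) :=
  Tm.lam (Tm.lam (Tm.lam (v1 ⬝ (stableC.ofClosed ⬝ v2 ⬝ v1 ⬝ v0))))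

/-- `λ A μ s n`, which is not `0` if `A (s * (n + 1))` is not eventually constant. -/
def unstableC : Tm [] (apxTy ⇒ ty2 ⇒ natSeq ⇒ ty1) :=
  Tm.lam (Tm.lam (Tm.lam (Tm.lam (ifLe
    (stableC.ofClosed ⬝ v3 ⬝ v2 ⬝ snoc v1 (suc v0) ⬝
      (limC.ofClosed ⬝ v3 ⬝ v2 ⬝ snoc v1 (suc v0))) zero (suc zero) zero))))

/-- `λ A μ s`, the extension of `s` by an entry found by `unstableC`. -/
def extendC : Tm [] (apxTy ⇒ ty2 ⇒ natSeq ⇒ natSeq) :=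
  Tm.lam (Tm.lam (Tm.lam (snoc v0 (suc (v1 ⬝ (unstableC.ofClosed ⬝ v2 ⬝ v1 ⬝ v0))))))

/-- `λ g s n`, the `n`-fold iterate of `g` at `s`. -/
def iterC : Tm [] ((natSeq ⇒ natSeq) ⇒ natSeq ⇒ Ty.nat ⇒ natSeq) :=
  Tm.lam (Tm.lam (Tm.lam (natRec v0 v1 (Tm.lam (Tm.lam (v4 ⬝ v1))))))

/-- `λ q n`, the entry with index `n` of `q (n + 1)`. -/
def diagC : Tm [] ((Ty.nat ⇒ natSeq) ⇒ ty1) :=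
  Tm.lam (Tm.lam (get (v1 ⬝ suc v0) v0))

variable {M : Str} [hM : M.IsModel]

/-- From the standard number `k` on, for some `k`, the values `A s N` do not depend on `N`. -/
def Stable (A : M.C apxTy) (s : M.C natSeq) : Prop :=
  ∃ k, M.st k ∧ ∀ N, k ≤ N → A ⬩ s ⬩ N = A ⬩ s ⬩ k

theorem differ_eq_zero (A : M.C apxTy) (s : M.C natSeq) (k N : M.C Ty.nat) :
    differC.val Env.nil ⬩ A ⬩ s ⬩ k ⬩ N = 0 ↔ (k ≤ N → A ⬩ s ⬩ N = A ⬩ s ⬩ k) := by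
  simp only [differC, lam_app, val_ifLe, sifLe_eq, val_app, val_zero, val_suc, val_v0, val_v1,
    val_v2, val_v3]
  split_ifs with h₁ h₂ h₃
  · simp [h₁, le_antisymm h₂ h₃]
  · simp only [ns_ne_zero, false_iff, h₁, true_imp_iff]
    exact fun h => h₃ h.ge
  · simp only [ns_ne_zero, false_iff, h₁, true_imp_iff]
    exact fun h => h₂ h.le
  · simp [h₁]

theorem sifLe_one_zero (n : M.C Ty.nat) : sifLe n 0 (ns 0) (0 : M.C Ty.nat) ≠ 0 ↔ n = 0 := by
  simp only [sifLe_eq, nat_le_zero]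
  split_ifs with h <;> simp [h]

variable {μ : M.C ty2} (hμ : M.st μ)
  (hfind : ∀ f, M.st f → ∀ m, f ⬩ m ≠ 0 → f ⬩ (μ ⬩ f) ≠ 0) {A : M.C apxTy} (hA : M.st A)

include hfind hA

/-- For standard `s` and `k`, the test function `differC` is standard, so testing it at the place
proposed by `μ` decides the quantifier over all `N`, nonstandard ones included. -/
theorem stableC_iff {s : M.C natSeq} {k : M.C Ty.nat} (hs : M.st s) (hk : M.st k) :
    stableC.val Env.nil ⬩ A ⬩ μ ⬩ s ⬩ k ≠ 0 ↔ ∀ N, k ≤ N → A ⬩ s ⬩ N = A ⬩ s ⬩ k := by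
  have : stableC.val Env.nil ⬩ A ⬩ μ ⬩ s ⬩ k = sifLe (differC.val Env.nil ⬩ A ⬩ s ⬩ k ⬩
      (μ ⬩ (differC.val Env.nil ⬩ A ⬩ s ⬩ k))) 0 (ns 0) 0 := by
    simp [stableC]
  rw [this, sifLe_one_zero]
  constructor
  · intro h N
    rw [← differ_eq_zero]
    by_contra hN
    exact hfind _ (st_app (st_app (st_app (st_closed _) hA) hs) hk) N hN h
  · intro h
    rw [differ_eq_zero]
    exact h _

include hμ

/-- Stability is a nonzero value of the standard function `stableC`, so `μ` finds a threshold, and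
this threshold is standard. -/
theorem Stable.eq_of_limC_le {s : M.C natSeq} (hs : M.st s) (h : Stable A s) :
    ∀ N, limC.val Env.nil ⬩ A ⬩ μ ⬩ s ≤ N →
      A ⬩ s ⬩ N = A ⬩ s ⬩ (limC.val Env.nil ⬩ A ⬩ μ ⬩ s) := by
  obtain ⟨k, hk, h⟩ := h
  have hst : M.st (stableC.val Env.nil ⬩ A ⬩ μ ⬩ s) :=
    st_app (st_app (st_app (st_closed _) hA) hμ) hs
  have e : limC.val Env.nil ⬩ A ⬩ μ ⬩ s = μ ⬩ (stableC.val Env.nil ⬩ A ⬩ μ ⬩ s) := by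
    simp [limC]
  rw [e]
  exact (stableC_iff hfind hA hs (st_app hμ hst)).1
    (hfind _ hst k ((stableC_iff hfind hA hs hk).2 h))

omit hfind in
theorem st_limC {s : M.C natSeq} (hs : M.st s) : M.st (limC.val Env.nil ⬩ A ⬩ μ ⬩ s) :=
  st_app (st_app (st_app (st_closed _) hA) hμ) hs

/-- At standard `n`, `unstableC` is nonzero exactly when `s * (n + 1)` is unstable. The place found
by `μ` is standard, so this characterisation applies to it too. -/
theorem not_stable_extend {s : M.C natSeq} (hs : M.st s)
    (h : ∃ n, M.st n ∧ ¬ Stable A (ssnoc s (ns n))) :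
    ¬ Stable A (extendC.val Env.nil ⬩ A ⬩ μ ⬩ s) := by
  have hst : M.st (unstableC.val Env.nil ⬩ A ⬩ μ ⬩ s) :=
    st_app (st_app (st_app (st_closed _) hA) hμ) hs
  have key : ∀ n, M.st n → (unstableC.val Env.nil ⬩ A ⬩ μ ⬩ s ⬩ n ≠ 0 ↔
      ¬ Stable A (ssnoc s (ns n))) := by
    intro n hn
    have hs' : M.st (ssnoc s (ns n)) := st_app (st_app (st_closed _) hs) (st_ns hn)
    have e : unstableC.val Env.nil ⬩ A ⬩ μ ⬩ s ⬩ n = sifLe (stableC.val Env.nil ⬩ A ⬩ μ ⬩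
        ssnoc s (ns n) ⬩ (limC.val Env.nil ⬩ A ⬩ μ ⬩ ssnoc s (ns n))) 0 (ns 0) 0 := by
      simp [unstableC]
    rw [e, sifLe_one_zero, iff_not_comm]
    have hk := st_limC hμ hA hs'
    rw [← ne_eq, stableC_iff hfind hA hs' hk]
    exact ⟨fun h => h.eq_of_limC_le hμ hfind hA hs', fun h => ⟨_, hk, h⟩⟩
  have e : extendC.val Env.nil ⬩ A ⬩ μ ⬩ s =
      ssnoc s (ns (μ ⬩ (unstableC.val Env.nil ⬩ A ⬩ μ ⬩ s))) := by
    simp [extendC]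
  obtain ⟨n, hn, h⟩ := h
  rw [e, ← key _ (st_app hμ hst)]
  exact hfind _ hst n ((key n hn).2 h)

omit hμ hfind hA

theorem spre_congr (s : M.C natSeq) (α β : M.C ty1) :
    ∀ n, (∀ m, m ≤ n → α ⬩ m = β ⬩ m) → spre s α ⬩ n = spre s β ⬩ n := by
  have := seq_ind (Fm.all Ty.nat (Fm.all Ty.nat (le v0 v1 ⇾ v3 ⬝ v0 ≐ v4 ⬝ v0) ⇾
      pre v1 v2 ⬝ v0 ≐ pre v1 v3 ⬝ v0))
    (Env.cons α (Env.cons β Env.nil)) (by simp) (fun n => by simpa using fun h => h n le_rfl)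
    (fun a s ih n => by
      simp only [sat_all, sat_imp, sat_eq, sat_le, val_app, val_pre, val_v0, val_v1,
        val_v2, val_v3, val_v4, spre_cons] at ih ⊢
      obtain rfl | ⟨n, rfl⟩ := nat_cases n
      · simp
      · intro h
        simpa using ih n fun m hm => h m (hm.trans (nat_le_ns n))) s
  simpa using this

theorem sshift_congr {α β : M.C ty1} {n : M.C Ty.nat} (h : ∀ m, m ≤ n → α ⬩ m = β ⬩ m)
    (x : M.C Ty.nat) : ∀ m, m ≤ n → sshift x α ⬩ m = sshift x β ⬩ m := by
  intro m hm
  obtain rfl | ⟨m, rfl⟩ := nat_cases m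
  · simp
  · simpa using h m ((nat_le_ns m).trans hm)

variable {Y : M.C ty2} {ω : M.C Ty.nat}

include hμ hfind hA in
/-- If all one-element extensions are stable, then so is the sequence itself. -/
theorem Stable.of_snoc (hN : M.NPC) (hω : ¬ M.st ω) (hY : M.st Y) (hc : Cont Y)
    (hrec : ∀ s N, slen s < N → ∃ β, A ⬩ s ⬩ N = Y ⬩ spre s (sshift 0 β) ∧
      ∀ n, ns n ≤ N → β ⬩ n = A ⬩ ssnoc s (ns n) ⬩ N)
    {s : M.C natSeq} (hs : M.st s) (h : ∀ n, M.st n → Stable A (ssnoc s (ns n))) : Stable A s := by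
  let t : Tm [Ty.nat, natSeq, ty2, apxTy] natSeq := snoc v1 (suc v0)
  let e : Env M [natSeq, ty2, apxTy] := Env.cons s (Env.cons μ (Env.cons A Env.nil))
  have he : e.St := .cons hs (.cons hμ (.cons hA .nil))
  -- `γ(n)` is the limit value at `s * (n + 1)`. It is standard because `limC` is a closed term and
  -- its arguments are standard.
  let γ : M.C ty1 := (Tm.lam (v3 ⬝ t ⬝ (limC.ofClosed ⬝ v3 ⬝ v2 ⬝ t))).val e
  have hγ : ∀ n, γ ⬩ n =
      A ⬩ ssnoc s (ns n) ⬩ (limC.val Env.nil ⬩ A ⬩ μ ⬩ ssnoc s (ns n)) := fun n => by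
    simp [γ, t, e]
  have hγst : M.st γ := st_val he _
  have hf : M.st (spre s (sshift 0 γ)) :=
    st_app (st_app (st_closed _) hs) (st_app (st_app (st_closed _) st_zero) hγst)
  have hlen : M.st (slen s) := st_app (st_closed _) hs
  have hval : ∀ N, ¬ M.st N → A ⬩ s ⬩ N = Y ⬩ spre s (sshift 0 γ) := by
    intro N hNst
    obtain ⟨β, h₁, h₂⟩ := hrec s N (lt_of_st hlen hNst)
    rw [h₁]
    -- For nonstandard `N` the recursion uses a `β` with `β ≈₁ γ`: at standard `m`, `N` lies beyond
    -- both `m + 1` and the standard threshold of `s * (m + 1)`.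
    refine (hN Y hY hc _ hf _ fun n hn => spre_congr _ _ _ _ (sshift_congr (fun m hm => ?_) _)).symm
    have hm := st_of_le hn m hm
    have hs' : M.st (ssnoc s (ns m)) := st_app (st_app (st_closed _) hs) (st_ns hm)
    rw [h₂ m (lt_of_st (st_ns hm) hNst).le, hγ]
    exact ((h m hm).eq_of_limC_le hμ hfind hA hs' N
      (lt_of_st (st_limC hμ hA hs') hNst).le).symm
  have := exists_st_of_forall_not_st (Fm.all Ty.nat (le v1 v0 ⇾ v2 ⬝ v3 ⬝ v0 ≐ v4))
    (Env.cons A (Env.cons s (Env.cons (Y ⬩ spre s (sshift 0 γ)) Env.nil))) (by simp) hω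
    (fun k hk => by
      simp only [sat_all, sat_imp, sat_le, sat_eq, val_app, val_v0, val_v1, val_v2, val_v3, val_v4]
      exact fun N hkN => hval N fun hNst => hk (st_of_le hNst k hkN))
  simp only [sat_all, sat_imp, sat_le, sat_eq, val_app, val_v0, val_v1, val_v2, val_v3,
    val_v4] at this
  obtain ⟨k, hk, h⟩ := this
  exact ⟨k, hk, fun N hkN => (h N hkN).trans (h k le_rfl).symm⟩

/-- The entries of an increasing sequence of finite sequences do not change. -/
theorem spre_path_eq {q : M.C (Ty.nat ⇒ natSeq)}
    (hq : ∀ n, ∃ x, q ⬩ ns n = ssnoc (q ⬩ n) x) {i n : M.C Ty.nat} (hn : n < slen (q ⬩ i))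
    (β : M.C ty1) (j : M.C Ty.nat) :
    i ≤ j → ∀ α, spre (q ⬩ j) α ⬩ n = spre (q ⬩ i) β ⬩ n := by
  have := nat_ind (le v1 v0 ⇾ Fm.all ty1
      (pre (v5 ⬝ v1) v0 ⬝ v3 ≐ pre (v5 ⬝ v2) v4 ⬝ v3))
    (Env.cons i (Env.cons n (Env.cons β (Env.cons q Env.nil)))) (by simp)
    (by
      simp only [sat_all, sat_imp, sat_le, sat_eq, val_app, val_pre, val_v0, val_v1, val_v2,
        val_v3, val_v4, val_v5, nat_le_zero]
      rintro rfl α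
      exact spre_app_congr _ _ _ n hn)
    (fun j ih => by
      simp only [sat_all, sat_imp, sat_le, sat_eq, val_app, val_pre, val_v0, val_v1, val_v2,
        val_v3, val_v4, val_v5] at ih ⊢
      intro hij α
      obtain hij | rfl := hij.lt_or_eq
      · obtain ⟨x, hx⟩ := hq j
        rw [hx, spre_snoc]
        exact ih (nat_lt_ns.1 hij) _
      · exact spre_app_congr _ _ _ n hn) j
  simpa using this

theorem le_slen_path {q : M.C (Ty.nat ⇒ natSeq)}
    (hq : ∀ n, ∃ x, q ⬩ ns n = ssnoc (q ⬩ n) x) (n : M.C Ty.nat) : n ≤ slen (q ⬩ n) := by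
  have := nat_ind (le v0 (len (v1 ⬝ v0))) (Env.cons q Env.nil) (by simp)
    (by simp [nat_zero_le])
    (fun n ih => by
      obtain ⟨x, hx⟩ := hq n
      simpa [hx, slen_snoc, ns_le_ns] using ih) n
  simpa using this

/-- `A` is stable at some point of each standard path. -/
theorem exists_stable_path (hN : M.NPC) (hω : ¬ M.st ω) (hY : M.st Y) (hc : Cont Y)
    (hbase : ∀ s N, slen s ≤ N → ∃ α, A ⬩ s ⬩ N = Y ⬩ spre s α)
    {q : M.C (Ty.nat ⇒ natSeq)} (hqst : M.st q) (hq : ∀ n, ∃ x, q ⬩ ns n = ssnoc (q ⬩ n) x) :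
    ∃ n, M.st n ∧ Stable A (q ⬩ n) := by
  let f : M.C ty1 := diagC.val Env.nil ⬩ q
  have hf : ∀ n, f ⬩ n = spre (q ⬩ ns n) szeros ⬩ n := fun n => by simp [f, diagC]
  -- `q (N₀ + 1)` has length at least `N₀ + 1`, so it fixes the entries `0, …, N₀` of the limit `f`,
  -- and `Y` takes the value `Y(f)` at all its infinite extensions.
  obtain ⟨N₀, hN₀, h⟩ := exists_st_modulus hN hω hY hc (f := f) (st_app (st_closed _) hqst)
  have hst : M.st (q ⬩ ns N₀) := st_app hqst (st_ns hN₀)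
  have hlen : M.st (slen (q ⬩ ns N₀)) := st_app (st_closed _) hst
  have hval : ∀ N, slen (q ⬩ ns N₀) ≤ N → A ⬩ (q ⬩ ns N₀) ⬩ N = Y ⬩ f := by
    intro N hN
    obtain ⟨α, hα⟩ := hbase _ N hN
    rw [hα, h (spre (q ⬩ ns N₀) α) fun n hn => ?_]
    rw [hf]
    exact spre_path_eq hq ((ns_le_iff _ _).1 (le_slen_path hq (ns n))) _ _ (ns_le_ns.2 hn) _
  exact ⟨ns N₀, st_ns hN₀, _, hlen, fun N hN => (hval N hN).trans (hval _ le_rfl).symm⟩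

include hA in
-- Bar induction by contradiction: `μ` replaces dependent choice in building a standard path of
-- unstable sequences.
theorem stable_of_recursion (hN : M.NPC) (hω : ¬ M.st ω) (hY : M.st Y) (hc : Cont Y)
    (hbase : ∀ s N, slen s ≤ N → ∃ α, A ⬩ s ⬩ N = Y ⬩ spre s α)
    (hrec : ∀ s N, slen s < N → ∃ β, A ⬩ s ⬩ N = Y ⬩ spre s (sshift 0 β) ∧
      ∀ n, ns n ≤ N → β ⬩ n = A ⬩ ssnoc s (ns n) ⬩ N)
    {s : M.C natSeq} (hs : M.st s) : Stable A s := by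
  obtain ⟨μ, hμ, hfind⟩ := exists_st_mu hN hω
  by_contra hcon
  let g : M.C (natSeq ⇒ natSeq) := extendC.val Env.nil ⬩ A ⬩ μ
  have hg : M.st g := st_app (st_app (st_closed _) hA) hμ
  let q : M.C (Ty.nat ⇒ natSeq) := iterC.val Env.nil ⬩ g ⬩ s
  have hq0 : q ⬩ 0 = s := by simp [q, iterC]
  have hqs : ∀ n, q ⬩ ns n = g ⬩ (q ⬩ n) := fun n => by
    have : ∀ t : M.C Ty.nat, (Tm.lam (Tm.lam (v4 ⬝ v1))).val
        (Env.cons t (Env.cons s (Env.cons g Env.nil))) =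
        (Tm.lam (Tm.lam (v2 ⬝ v1)) : Tm [natSeq ⇒ natSeq] (natSeq ⇒ Ty.nat ⇒ natSeq)).val
        (Env.cons g Env.nil) := fun t => funext_app fun _ => funext_app fun _ => by simp
    simp only [q, iterC, lam_app, val_natRec, val_v0, val_v1, val_v2, this, recN_suc, val_app]
  have hqst : M.st q := st_app (st_app (st_closed _) hg) hs
  have hunst : ∀ n, M.st n → ¬ Stable A (q ⬩ n) := by
    -- Stability refers to a standard threshold, so its failure is propagated along the path by
    -- external induction.
    have := nat_ind_st (Fm.exSt Ty.nat (Fm.all Ty.nat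
        (le v1 v0 ⇾ v3 ⬝ (v4 ⬝ v2) ⬝ v0 ≐ v3 ⬝ (v4 ⬝ v2) ⬝ v1))).neg
      (Env.cons A (Env.cons q Env.nil))
      (by simpa [hq0, Stable] using hcon)
      (fun n hn ih => by
        simp only [sat_neg, sat_exSt, sat_all, sat_imp, sat_le, sat_eq, val_app, val_v0, val_v1,
          val_v2, val_v3, val_v4] at ih ⊢
        change ¬ Stable A _ at ih
        change ¬ Stable A _
        rw [hqs]
        have hst : M.st (q ⬩ n) := st_app hqst hn
        refine not_stable_extend hμ hfind hA hst ?_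
        by_contra! hall
        exact ih (Stable.of_snoc hμ hfind hA hN hω hY hc hrec hst hall))
    intro n hn
    simpa [Stable] using this n hn
  obtain ⟨n, hn, h⟩ := exists_stable_path hN hω hY hc hbase hqst fun n =>
    ⟨ns (μ ⬩ (unstableC.val Env.nil ⬩ A ⬩ μ ⬩ (q ⬩ n))), by rw [hqs]; simp [g, extendC]⟩
  exact hunst n hn h

include hA in
/-- Approximations given by the recursion are `Ω`-invariant. -/
theorem apx_eq_of_not_st (hN : M.NPC) (hY : M.st Y) (hc : Cont Y)
    (hbase : ∀ s N, slen s ≤ N → ∃ α, A ⬩ s ⬩ N = Y ⬩ spre s α)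
    (hrec : ∀ s N, slen s < N → ∃ β, A ⬩ s ⬩ N = Y ⬩ spre s (sshift 0 β) ∧
      ∀ n, ns n ≤ N → β ⬩ n = A ⬩ ssnoc s (ns n) ⬩ N)
    {s : M.C natSeq} (hs : M.st s) {K N : M.C Ty.nat} (hK : ¬ M.st K) (hNst : ¬ M.st N) :
    A ⬩ s ⬩ N = A ⬩ s ⬩ K := by
  -- The given `K` serves as the nonstandard number required for underspill.
  obtain ⟨k, hk, h⟩ := stable_of_recursion hA hN hK hY hc hbase hrec hs
  exact (h N (lt_of_st hk hNst).le).trans (h K (lt_of_st hk hK).le).symm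

theorem sat_invG (hN : M.NPC) : invG.Sat (Env.nil (M := M)) := by
  simp only [invG, sat_allSt, sat_imp, sat_cont, sat_allInf, sat_eq, val_appG, val_v0, val_v1,
    val_v2, val_v3]
  intro Y hY hc s hs K hK N hNst
  refine apx_eq_of_not_st (A := G.val Env.nil ⬩ Y) (st_app (st_closed _) hY) hN hY hc ?_ ?_ hs
    hK hNst
  · intro s N h
    obtain h | h := h.lt_or_eq
    · obtain ⟨β, hβ, -⟩ := sG_of_lt Y h
      exact ⟨_, hβ⟩
    · exact ⟨_, sG_of_le Y h.ge⟩
  · intro s N h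
    obtain ⟨β, h₁, h₂⟩ := sG_of_lt Y h
    exact ⟨β, h₁, fun n _ => h₂ n⟩

theorem sat_invH (hN : M.NPC) : invH.Sat (Env.nil (M := M)) := by
  simp only [invH, sat_allSt, sat_imp, sat_cont, sat_allInf, sat_eq, val_appH, val_v0, val_v1,
    val_v2, val_v3]
  intro Y hY hc s hs K hK N hNst
  refine apx_eq_of_not_st (A := H.val Env.nil ⬩ Y) (st_app (st_closed _) hY) hN hY hc ?_ ?_ hs
    hK hNst
  · intro s N h
    obtain h | h := h.lt_or_eq
    · obtain ⟨β, hβ, -⟩ := sH_of_lt Y h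
      exact ⟨_, hβ⟩
    · exact ⟨_, (sH_of_le Y h.ge).trans (by rw [strunc_eq s N h.le])⟩
  · intro s N h
    obtain ⟨β, h₁, h₂⟩ := sH_of_lt Y h
    -- `H` continues with zeros after `s * N`; the recursion hypothesis asks only about entries `n +
    -- 1 ≤ N`, where this cut has no effect.
    exact ⟨β, h₁, fun n hn => (h₂ n).trans (sifLe_of_le hn _ _)⟩

end Invariance

end PSys

/-- `P` proves the defining equations of the closed terms `G` and `H`, and `P + NPC + STP` proves
that the canonical approximations `H(Y, s, N)` and `G(Y, s, N)` are `Ω`-invariant. -/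
theorem theorem4p1 :
    (PSys.Derives [] PSys.defH ∧ PSys.Derives [] PSys.defG) ∧
      PSys.Derives [PSys.NPC, PSys.STP] PSys.invH ∧
      PSys.Derives [PSys.NPC, PSys.STP] PSys.invG := by
  refine ⟨⟨PSys.derives_of_forall_model fun M _ _ => PSys.sat_defH,
    PSys.derives_of_forall_model fun M _ _ => PSys.sat_defG⟩,
    PSys.derives_of_forall_model fun M _ h => PSys.sat_invH (PSys.sat_NPC.1 (h _ (by simp))),
    PSys.derives_of_forall_model fun M _ h => PSys.sat_invG (PSys.sat_NPC.1 (h _ (by simp)))⟩
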